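/- Let $K$ be a field of characteristic zero (for example $K=\mathbb C$), let $M,N$ be non-negative integers, let $\boldsymbol z=(z_1,\dots,z_N)$ be pairwise distinct elements of $K$ and let $\boldsymbol\lambda=(\lambda_1,\dots,\lambda_M)$ be pairwise distinct elements of $K$. **Notation.** For an $n\times n$ matrix $(a_{ij})$ over a noncommutative ring put $\operatorname{rdet}(a)=\sum_{\sigma\in S_n}\operatorname{sgn}(\sigma)\,a_{1\sigma(1)}a_{2\sigma(2)}\cdots a_{n\sigma(n)}$. Let $E_{ij}$ be the matrix units of $\mathfrak{gl}_M$ and let $E_{ij}^{(a)}=1^{\otimes(a-1)}\otimes E_{ij}\otimes 1^{\otimes(N-a)}\in (U\mathfrak{gl}_M)^{\otimes N}$. Consider the $M\times M$ matrix $$\widetilde G(M,N,\boldsymbol z,\boldsymbol\lambda,u)=\Big(\big(\tfrac{\partial}{\partial u}-\lambda_i\big)\delta_{ij}-\sum_{a=1}^N\frac{E_{ji}^{(a)}}{u-z_a}\Big)_{i,j=1}^M,$$ whose entries are differential operators in $u$ with coefficients that are rational functions of $u$ with values in $(U\mathfrak{gl}_M)^{\otimes N}$, and write $$\operatorname{rdet}\widetilde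 G(M,N,\boldsymbol z,\boldsymbol\lambda,u)=\frac{\partial^M}{\partial u^M}+\widetilde G_1(u)\frac{\partial^{M-1}}{\partial u^{M-1}}+\dots+\widetilde G_M(u).$$ For $1\le i\le M$ the product $\widetilde G_i(u)\prod_{a=1}^N(u-z_a)^i$ is a polynomial in $u$. The Bethe subalgebra $\mathcal G(M,N,\boldsymbol z,\boldsymbol\lambda)\subset (U\mathfrak{gl}_M)^{\otimes N}$ is the unital subalgebra generated by the coefficients of these polynomials for $i=1,\dots,M$. Exchanging the roles of $(M,\boldsymbol\lambda)$ and $(N,\boldsymbol z)$ one gets $\widetilde G(N,M,\boldsymbol\lambda,\boldsymbol z,v)$ and $\mathcal G(N,M,\boldsymbol\lambda,\boldsymbol z)\subset(U\mathfrak{gl}_N)^{\otimes M}$. Let $L=K[x_{ij}:1\le i\le M,\ 1\le j\le N]$, and let $\pi^{(M)}:(U\mathfrak{gl}_M)^{\otimes N}\to\operatorname{End}(L)$ and $\pi^{(N)}:(U\mathfrak{gl}_N)^{\otimes M}\to\operatorname{End}(L)$ be the algebra homomorphisms with $$\pi^{(M)}(E_{ij}^{(a)})=x_{ia}\frac{\partial}{\partial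 x_{ja}},\qquad \pi^{(N)}(E_{ij}^{(a)})=x_{ai}\frac{\partial}{\partial x_{aj}},$$ applied to differential operators in $u$ or $v$ coefficientwise. **Theorem.** We have $$\pi^{(M)}\big(\mathcal G(M,N,\boldsymbol z,\boldsymbol\lambda)\big)=\pi^{(N)}\big(\mathcal G(N,M,\boldsymbol\lambda,\boldsymbol z)\big).$$ Moreover, there are operators $A^{(M)}_{ab},A^{(N)}_{ab}\in\operatorname{End}(L)$, $0\le a\le N$, $0\le b\le M$ (independent of $u,v,\partial/\partial u,\partial/\partial v$), such that $$\prod_{a=1}^N(u-z_a)\;\pi^{(M)}\operatorname{rdet}\widetilde G(M,N,\boldsymbol z,\boldsymbol\lambda,u)=\sum_{a=0}^N\sum_{b=0}^M A^{(M)}_{ab}\,u^a\frac{\partial^b}{\partial u^b},$$ $$\prod_{b=1}^M(v-\lambda_b)\;\pi^{(N)}\operatorname{rdet}\widetilde G(N,M,\boldsymbol\lambda,\boldsymbol z,v)=\sum_{a=0}^N\sum_{b=0}^M A^{(N)}_{ab}\,v^b\frac{\partial^a}{\partial v^a},$$ and $$A^{(M)}_{ab}=A^{(N)}_{ab}\qquad\text{for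 all }a,b.$$ -/

import Mathlib

open scoped TensorProduct Polynomial

noncomputable section

/-! ### Row determinants -/

/-- The row determinant `∑ σ, sgn(σ) a_{1σ(1)} ⋯ a_{nσ(n)}` of a square matrix with entries in a
(noncommutative) ring; in each summand the factors are multiplied in the order of the rows. -/
def rdet {S : Type*} [Ring S] {n : ℕ} (a : Matrix (Fin n) (Fin n) S) : S :=
  ∑ σ : Equiv.Perm (Fin n), (Equiv.Perm.sign σ : ℤ) • (List.ofFn fun i => a i (σ i)).prod

/-! ### Formal differential operators over a differential ring -/

/-- A derivation of a not necessarily commutative ring into itself. -/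
structure NCDerivation (R : Type*) [Ring R] extends R →+ R where
  leibniz' : ∀ a b : R, toFun (a * b) = toFun a * b + a * toFun b

/-- The ring `R[∂; δ]` of differential operators `∑ r_i ∂^i` with coefficients `r_i ∈ R` written
on the left, whose multiplication is determined by `∂ r = r ∂ + δ(r)`. As an additive group it
consists of the finite families of coefficients `(r_i)`. -/
def OreRing {R : Type*} [Ring R] (_δ : NCDerivation R) : Type _ := R[X]

namespace OreRing

variable {R : Type*} [Ring R] (δ : NCDerivation R)

instance instAddCommGroup : AddCommGroup (OreRing δ) := inferInstanceAs (AddCommGroup R[X])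

/-- Application of `δ` to all the coefficients. -/
def derivCoeffs : Module.End ℤ R[X] :=
  AddMonoidHom.toIntLinearMap
    { toFun := fun p => p.sum fun n c => Polynomial.monomial n (δ.toAddMonoidHom c)
      map_zero' := by simp
      map_add' := fun p q => Polynomial.sum_add_index p q _ (by simp) (by simp) }

/-- Left multiplication by `∂`: `∂ (∑ r_i ∂^i) = ∑ r_i ∂^(i+1) + ∑ δ(r_i) ∂^i`. -/
def dMul : Module.End ℤ R[X] :=
  LinearMap.mulLeft ℤ (Polynomial.X : R[X]) + derivCoeffs δ

/-- Left multiplication by an operator: `(∑ r_i ∂^i) q = ∑ r_i (∂^i q)`. -/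
def leftMul : R[X] →+ Module.End ℤ R[X] where
  toFun p := p.sum fun i c => LinearMap.mulLeft ℤ (Polynomial.C c) * dMul δ ^ i
  map_zero' := by simp
  map_add' p q := by
    refine Polynomial.sum_add_index p q _ ?_ ?_
    · intro i
      refine LinearMap.ext fun x => ?_
      simp
    · intro i a b
      refine LinearMap.ext fun x => ?_
      simp [Module.End.mul_apply, add_mul]

/-- The coefficient of `∂^i` in an operator written with coefficients on the left. -/
def coeff (p : OreRing δ) (i : ℕ) : R := Polynomial.coeff (R := R) p i

/-- A coefficient as an operator of order zero. -/
def C (r : R) : OreRing δ := (Polynomial.C r : R[X])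

/-- The operator `∂`. -/
def D : OreRing δ := (Polynomial.X : R[X])

instance instOne : One (OreRing δ) := ⟨(1 : R[X])⟩

instance instMul : Mul (OreRing δ) := ⟨fun p q => leftMul δ p q⟩

lemma mul_def (p q : OreRing δ) : p * q = leftMul δ p q := rfl

@[simp] lemma derivCoeffs_monomial (n : ℕ) (c : R) :
    derivCoeffs δ (Polynomial.monomial n c) = Polynomial.monomial n (δ.toAddMonoidHom c) := by
  exact Polynomial.sum_monomial_index (S := R[X]) c
    (fun n c => Polynomial.monomial n (δ.toAddMonoidHom c)) (by simp)

lemma leftMul_monomial (n : ℕ) (c : R) :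
    leftMul δ (Polynomial.monomial n c) =
      LinearMap.mulLeft ℤ (Polynomial.C c) * dMul δ ^ n := by
  refine Polynomial.sum_monomial_index (S := Module.End ℤ R[X]) c
    (fun i c => LinearMap.mulLeft ℤ (Polynomial.C c) * dMul δ ^ i) ?_
  refine LinearMap.ext fun x => ?_
  simp

lemma leftMul_one : leftMul δ 1 = 1 := by
  have := leftMul_monomial δ 0 1
  rw [Polynomial.monomial_zero_left, Polynomial.C_1] at this
  rw [this]
  refine LinearMap.ext fun x => ?_
  simp

lemma derivCoeffs_one : derivCoeffs δ 1 = 0 := by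
  have h := derivCoeffs_monomial δ 0 1
  have h1 : δ.toAddMonoidHom 1 = 0 := by
    have := δ.leibniz' 1 1
    simp only [mul_one, one_mul] at this
    change δ.toFun 1 = 0
    simpa using this
  rw [h1] at h
  simpa using h

lemma dMul_pow_one (n : ℕ) : (dMul δ ^ n) 1 = Polynomial.X ^ n := by
  induction n with
  | zero => simp
  | succ n ih =>
    rw [pow_succ', Module.End.mul_apply, ih]
    have h := derivCoeffs_monomial δ n 1
    have h1 : δ.toAddMonoidHom 1 = 0 := by
      have := δ.leibniz' 1 1
      simp only [mul_one, one_mul] at this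
      change δ.toFun 1 = 0
      simpa using this
    rw [h1, map_zero, Polynomial.monomial_one_right_eq_X_pow] at h
    simp [dMul, h, pow_succ', LinearMap.add_apply]

lemma leftMul_apply_one (p : R[X]) : leftMul δ p 1 = p := by
  induction p using Polynomial.induction_on' with
  | add p q hp hq => rw [map_add, LinearMap.add_apply, hp, hq]
  | monomial n a =>
    rw [leftMul_monomial, Module.End.mul_apply, dMul_pow_one]
    simp [Polynomial.C_mul_X_pow_eq_monomial]

lemma dMul_mul_mulLeft (c : R) :
    dMul δ * LinearMap.mulLeft ℤ (Polynomial.C c) =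
      LinearMap.mulLeft ℤ (Polynomial.C c) * dMul δ +
        LinearMap.mulLeft ℤ (Polynomial.C (δ.toAddMonoidHom c)) := by
  refine LinearMap.ext fun p => ?_
  induction p using Polynomial.induction_on' with
  | add p q hp hq => rw [map_add, hp, hq, map_add]
  | monomial n a =>
    have hl : δ.toAddMonoidHom (c * a) = δ.toAddMonoidHom c * a + c * δ.toAddMonoidHom a :=
      δ.leibniz' c a
    simp only [Module.End.mul_apply, LinearMap.add_apply, dMul, LinearMap.mulLeft_apply,
      Polynomial.C_mul_monomial, derivCoeffs_monomial, Polynomial.X_mul_monomial, hl, map_add,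
      mul_add]
    abel

lemma leftMul_dMul (q : R[X]) : leftMul δ (dMul δ q) = dMul δ * leftMul δ q := by
  induction q using Polynomial.induction_on' with
  | add p q hp hq => rw [map_add, map_add, hp, hq, map_add, mul_add]
  | monomial n a =>
    have hd : dMul δ (Polynomial.monomial n a) = Polynomial.monomial (n + 1) a +
        Polynomial.monomial n (δ.toAddMonoidHom a) := by
      simp only [dMul, LinearMap.add_apply, LinearMap.mulLeft_apply, Polynomial.X_mul_monomial,
        derivCoeffs_monomial]
    rw [hd, leftMul_monomial, ← mul_assoc, dMul_mul_mulLeft, map_add, leftMul_monomial,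
      leftMul_monomial, pow_succ', add_mul, mul_assoc]

lemma leftMul_C_mul (c : R) (q : R[X]) :
    leftMul δ (Polynomial.C c * q) = LinearMap.mulLeft ℤ (Polynomial.C c) * leftMul δ q := by
  induction q using Polynomial.induction_on' with
  | add p q hp hq => rw [mul_add, map_add, hp, hq, map_add, mul_add]
  | monomial n a =>
    rw [Polynomial.C_mul_monomial, leftMul_monomial, leftMul_monomial, ← mul_assoc]
    congr 1
    refine LinearMap.ext fun x => ?_
    simp [Module.End.mul_apply]

lemma leftMul_leftMul (p q : R[X]) : leftMul δ (leftMul δ p q) = leftMul δ p * leftMul δ q := by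
  induction p using Polynomial.induction_on' with
  | add p p' hp hq =>
    rw [map_add, LinearMap.add_apply, map_add, hp, hq, add_mul]
  | monomial n a =>
    rw [leftMul_monomial, Module.End.mul_apply, LinearMap.mulLeft_apply, leftMul_C_mul,
      mul_assoc]
    congr 1
    induction n with
    | zero => simp
    | succ n ih => rw [pow_succ', Module.End.mul_apply, leftMul_dMul, ih, mul_assoc]

instance instRing : Ring (OreRing δ) := { instAddCommGroup δ, instOne δ, instMul δ with
  left_distrib p q r := map_add (leftMul δ p) q r
  right_distrib p q r := by
    exact LinearMap.congr_fun (map_add (leftMul δ) p q) r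
  zero_mul p := by
    exact LinearMap.congr_fun (map_zero (leftMul δ)) p
  mul_zero p := map_zero (leftMul δ p)
  mul_assoc p q r := by
    exact LinearMap.congr_fun (leftMul_leftMul δ p q) r
  one_mul p := by
    exact LinearMap.congr_fun (leftMul_one δ) p
  mul_one p := leftMul_apply_one δ p }

lemma coeff_add (p q : OreRing δ) (i : ℕ) : coeff δ (p + q) i = coeff δ p i + coeff δ q i :=
  Polynomial.coeff_add (R := R) p q i

lemma coeff_C_mul (r : R) (p : OreRing δ) (i : ℕ) : coeff δ (C δ r * p) i = r * coeff δ p i := by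
  have h : C δ r * p = (Polynomial.C r * (id p : R[X]) : R[X]) := by
    change leftMul δ (Polynomial.C r) p = _
    rw [← Polynomial.monomial_zero_left, leftMul_monomial, pow_zero, mul_one,
      Polynomial.monomial_zero_left]
    rfl
  rw [h]
  exact Polynomial.coeff_C_mul (R := R) _

lemma C_mul_C (r r' : R) : C δ r * C δ r' = C δ (r * r') := by
  change leftMul δ (Polynomial.C r) (Polynomial.C r') = (Polynomial.C (r * r') : R[X])
  have h := leftMul_monomial δ 0 r
  rw [Polynomial.monomial_zero_left, pow_zero, mul_one] at h
  rw [h, Polynomial.C_mul]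
  rfl

lemma D_mul (p : OreRing δ) : D δ * p = dMul δ p := by
  change leftMul δ Polynomial.X p = _
  rw [← Polynomial.monomial_one_one_eq_X, leftMul_monomial, pow_one, Polynomial.C_1]
  exact one_mul (dMul δ p : R[X])

lemma coeff_derivCoeffs (p : R[X]) (i : ℕ) :
    (derivCoeffs δ p).coeff i = δ.toAddMonoidHom (p.coeff i) := by
  induction p using Polynomial.induction_on' with
  | add p q hp hq => rw [map_add, Polynomial.coeff_add, hp, hq, Polynomial.coeff_add, map_add]
  | monomial n a =>
    rw [derivCoeffs_monomial, Polynomial.coeff_monomial, Polynomial.coeff_monomial]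
    split_ifs <;> simp

lemma coeff_D_mul_zero (p : OreRing δ) :
    coeff δ (D δ * p) 0 = δ.toAddMonoidHom (coeff δ p 0) := by
  have h : ∀ q : R[X], (Polynomial.X * q + derivCoeffs δ q).coeff 0 =
      δ.toAddMonoidHom (q.coeff 0) := by
    intro q
    rw [Polynomial.coeff_add, Polynomial.coeff_X_mul_zero, zero_add, coeff_derivCoeffs]
  rw [D_mul]
  exact h p

lemma coeff_D_mul_succ (p : OreRing δ) (i : ℕ) :
    coeff δ (D δ * p) (i + 1) = coeff δ p i + δ.toAddMonoidHom (coeff δ p (i + 1)) := by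
  have h : ∀ q : R[X], (Polynomial.X * q + derivCoeffs δ q).coeff (i + 1) =
      q.coeff i + δ.toAddMonoidHom (q.coeff (i + 1)) := by
    intro q
    rw [Polynomial.coeff_add, Polynomial.coeff_X_mul, coeff_derivCoeffs]
  rw [D_mul]
  exact h p

end OreRing

/-! ### Differential operators in one variable with operator-valued rational coefficients -/

section DiffOps

variable (K : Type*) [Field K]

/-- The derivative `(p/q)' = (p' q - p q') / q²` of a rational function. -/
def ratDeriv (f : RatFunc K) : RatFunc K :=
  algebraMap K[X] (RatFunc K)
      (Polynomial.derivative f.num * f.denom - f.num * Polynomial.derivative f.denom) /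
    algebraMap K[X] (RatFunc K) f.denom ^ 2

lemma ratDeriv_div (p q : K[X]) (hq : q ≠ 0) :
    ratDeriv K (algebraMap K[X] (RatFunc K) p / algebraMap K[X] (RatFunc K) q) =
      algebraMap K[X] (RatFunc K)
          (Polynomial.derivative p * q - p * Polynomial.derivative q) /
        algebraMap K[X] (RatFunc K) q ^ 2 := by
  set f := algebraMap K[X] (RatFunc K) p / algebraMap K[X] (RatFunc K) q with hf
  have hd : f.denom ≠ 0 := f.denom_ne_zero
  have hd' : algebraMap K[X] (RatFunc K) f.denom ≠ 0 := RatFunc.algebraMap_ne_zero hd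
  have hq' : algebraMap K[X] (RatFunc K) q ≠ 0 := RatFunc.algebraMap_ne_zero hq
  have key : f.num * q = p * f.denom := by
    apply RatFunc.algebraMap_injective K
    have h1 := f.num_div_denom
    rw [hf, ← hf, div_eq_iff hd'] at h1
    rw [map_mul, map_mul, h1, hf]
    field_simp
  have key' := congrArg Polynomial.derivative key
  simp only [Polynomial.derivative_mul] at key'
  unfold ratDeriv
  rw [div_eq_div_iff (pow_ne_zero 2 hd') (pow_ne_zero 2 hq'), ← map_pow, ← map_pow, ← map_mul,
    ← map_mul]
  refine congrArg (algebraMap K[X] (RatFunc K)) ?_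
  linear_combination (q * f.denom) * key' - (Polynomial.derivative f.denom * q +
    f.denom * Polynomial.derivative q) * key

/-- Every rational function is a quotient of two polynomials. -/
lemma ratFunc_exists_div (f : RatFunc K) : ∃ p q : K[X], q ≠ 0 ∧
    f = algebraMap K[X] (RatFunc K) p / algebraMap K[X] (RatFunc K) q :=
  ⟨f.num, f.denom, f.denom_ne_zero, f.num_div_denom.symm⟩

lemma ratDeriv_add (f g : RatFunc K) : ratDeriv K (f + g) = ratDeriv K f + ratDeriv K g := by
  obtain ⟨p, q, hq, rfl⟩ := ratFunc_exists_div K f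
  obtain ⟨r, s, hs, rfl⟩ := ratFunc_exists_div K g
  have hq' : algebraMap K[X] (RatFunc K) q ≠ 0 := RatFunc.algebraMap_ne_zero hq
  have hs' : algebraMap K[X] (RatFunc K) s ≠ 0 := RatFunc.algebraMap_ne_zero hs
  rw [div_add_div _ _ hq' hs', ← map_mul, ← map_mul, ← map_mul, ← map_add,
    ratDeriv_div K _ _ (mul_ne_zero hq hs), ratDeriv_div K _ _ hq, ratDeriv_div K _ _ hs]
  simp only [Polynomial.derivative_mul, map_sub, map_add, map_mul]
  field_simp
  ring

lemma ratDeriv_mul (f g : RatFunc K) :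
    ratDeriv K (f * g) = ratDeriv K f * g + f * ratDeriv K g := by
  obtain ⟨p, q, hq, rfl⟩ := ratFunc_exists_div K f
  obtain ⟨r, s, hs, rfl⟩ := ratFunc_exists_div K g
  have hq' : algebraMap K[X] (RatFunc K) q ≠ 0 := RatFunc.algebraMap_ne_zero hq
  have hs' : algebraMap K[X] (RatFunc K) s ≠ 0 := RatFunc.algebraMap_ne_zero hs
  rw [div_mul_div_comm, ← map_mul, ← map_mul,
    ratDeriv_div K _ _ (mul_ne_zero hq hs), ratDeriv_div K _ _ hq, ratDeriv_div K _ _ hs]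
  simp only [Polynomial.derivative_mul, map_sub, map_add, map_mul]
  field_simp
  ring

/-- The derivative of rational functions as a linear map. -/
def ratDerivLin : RatFunc K →ₗ[K] RatFunc K where
  toFun := ratDeriv K
  map_add' := ratDeriv_add K
  map_smul' c f := by
    have hc : ratDeriv K (algebraMap K (RatFunc K) c) = 0 := by
      have := ratDeriv_div K (Polynomial.C c) 1 one_ne_zero
      simpa using this
    rw [Algebra.smul_def, ratDeriv_mul, hc, zero_mul, zero_add, RingHom.id_apply,
      Algebra.smul_def]

variable (A : Type*) [Ring A] [Algebra K A]

/-- The derivation `d/du` of the ring `K(u) ⊗ A` of rational functions in `u` with values in `A`;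
it is zero on `A`. -/
def valuedDeriv : NCDerivation (RatFunc K ⊗[K] A) where
  toAddMonoidHom := (LinearMap.rTensor A (ratDerivLin K)).toAddMonoidHom
  leibniz' x y := by
    change LinearMap.rTensor A (ratDerivLin K) (x * y) =
      LinearMap.rTensor A (ratDerivLin K) x * y + x * LinearMap.rTensor A (ratDerivLin K) y
    induction x using TensorProduct.induction_on with
    | zero => simp
    | add x x' hx hx' => simp only [add_mul, map_add, hx, hx']; abel
    | tmul f a =>
      induction y using TensorProduct.induction_on with
      | zero => simp
      | add y y' hy hy' => simp only [mul_add, map_add, hy, hy']; abel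
      | tmul g b =>
        simp only [Algebra.TensorProduct.tmul_mul_tmul, LinearMap.rTensor_tmul,
          ← TensorProduct.add_tmul]
        congr 1
        exact ratDeriv_mul K f g

/-- Differential operators in `u` whose coefficients are rational functions in `u` with values in
the algebra `A`. -/
abbrev DiffOp : Type _ := OreRing (valuedDeriv K A)

variable {K}

/-- Multiplication by the scalar rational function `f(u)`. -/
def DiffOp.scalar (f : RatFunc K) : DiffOp K A := OreRing.C _ (f ⊗ₜ[K] (1 : A))

/-- The operator `∂/∂u`. -/
def DiffOp.partial : DiffOp K A := OreRing.D _

variable {A}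

/-- An element of `A` as a differential operator that does not involve `u` and `∂/∂u`. -/
def DiffOp.const (x : A) : DiffOp K A := OreRing.C _ ((1 : RatFunc K) ⊗ₜ[K] x)

/-- The map of differential operators that an algebra homomorphism `A → B` induces on
coefficients. -/
def DiffOp.map {B : Type*} [Ring B] [Algebra K B] (φ : A →ₐ[K] B) (P : DiffOp K A) : DiffOp K B :=
  Polynomial.map (R := RatFunc K ⊗[K] A) (S := RatFunc K ⊗[K] B)
    (Algebra.TensorProduct.map (AlgHom.id K (RatFunc K)) φ).toRingHom P

/-- The polynomial `∑ a_n u^n` with coefficients in `A`, as an `A`-valued rational function. -/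
def valuedPoly (p : A[X]) : RatFunc K ⊗[K] A :=
  ∑ n ∈ p.support, (RatFunc.X ^ n : RatFunc K) ⊗ₜ[K] p.coeff n

/-- The linear polynomial `u - c` as a rational function. -/
def uSub (c : K) : RatFunc K := RatFunc.X - RatFunc.C c

/-- The `M × M` matrix with entries
`(∂/∂u - λ_i) δ_ij - ∑_a e_{ji}^{(a)} / (u - z_a)`, for given elements `e_{ij}^{(a)}` of `A`. -/
def gaudinMatrix {M N : ℕ} (z : Fin N → K) (lam : Fin M → K)
    (e : Fin N → Fin M → Fin M → A) : Matrix (Fin M) (Fin M) (DiffOp K A) :=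
  Matrix.of fun i j =>
    (if i = j then DiffOp.partial A - DiffOp.scalar A (RatFunc.C (lam i)) else 0) -
      ∑ a, DiffOp.scalar A (uSub (z a))⁻¹ * DiffOp.const (e a j i)

end DiffOps

/-! ### The Bethe subalgebra -/

section Bethe

attribute [local instance] LieRing.ofAssociativeRing

variable (K : Type*) [Field K]

/-- The universal enveloping algebra of `gl_M`. -/
abbrev Ugl (M : ℕ) : Type _ := UniversalEnvelopingAlgebra K (Matrix (Fin M) (Fin M) K)

/-- The algebra `(U gl_M)^{⊗ N}`. -/
abbrev UglTensor (M N : ℕ) : Type _ := ⨂[K] _ : Fin N, Ugl K M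

/-- The element `E_ij^{(a)} = 1 ⊗ ⋯ ⊗ E_ij ⊗ ⋯ ⊗ 1` with `E_ij` in the `a`-th factor. -/
def glE (M N : ℕ) (a : Fin N) (i j : Fin M) : UglTensor K M N :=
  PiTensorProduct.singleAlgHom a
    (UniversalEnvelopingAlgebra.ι K (Matrix.single i j (1 : K)))

variable {K}

/-- The matrix `G̃(M, N, z, λ, u)`. -/
def Gtilde (M N : ℕ) (z : Fin N → K) (lam : Fin M → K) :
    Matrix (Fin M) (Fin M) (DiffOp K (UglTensor K M N)) :=
  gaudinMatrix z lam (glE K M N)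

/-- The transfer matrix `G̃_i(M, N, z, λ, u)`: the coefficient of `(∂/∂u)^{M-i}` in
`rdet G̃(M, N, z, λ, u)`, used for `1 ≤ i ≤ M`. -/
def transferMatrix (M N : ℕ) (z : Fin N → K) (lam : Fin M → K) (i : ℕ) :
    RatFunc K ⊗[K] UglTensor K M N :=
  OreRing.coeff _ (rdet (Gtilde M N z lam)) (M - i)

/-- The Bethe subalgebra `𝒢(M, N, z, λ)` of `(U gl_M)^{⊗ N}`: the unital subalgebra generated by
the coefficients of the polynomials `∏_a (u - z_a)^i · G̃_i(M, N, z, λ, u)`, `i = 1, …, M`. -/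
def betheSubalgebra (M N : ℕ) (z : Fin N → K) (lam : Fin M → K) :
    Subalgebra K (UglTensor K M N) :=
  Algebra.adjoin K {x | ∃ i : ℕ, 1 ≤ i ∧ i ≤ M ∧ ∃ p : (UglTensor K M N)[X],
    valuedPoly p = ((∏ a, uSub (z a) ^ i) ⊗ₜ[K] (1 : UglTensor K M N)) *
      transferMatrix M N z lam i ∧ ∃ n : ℕ, x = p.coeff n}

/-! The functions in the definition of the Bethe subalgebra are indeed polynomials. -/

section Polynomiality

variable (A : Type*) [Ring A] [Algebra K A]

variable (K) in
/-- The subalgebra `K[u] ⊗ A` of `K(u) ⊗ A`. -/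
def polySub : Subalgebra K (RatFunc K ⊗[K] A) :=
  (Algebra.TensorProduct.map (IsScalarTower.toAlgHom K K[X] (RatFunc K)) (AlgHom.id K A)).range

variable {A}

lemma tmul_mem_polySub (q : K[X]) (a : A) :
    (algebraMap K[X] (RatFunc K) q) ⊗ₜ[K] a ∈ polySub K A := ⟨q ⊗ₜ a, by simp⟩

lemma valuedPoly_add (p q : A[X]) :
    valuedPoly (K := K) (p + q) = valuedPoly p + valuedPoly q :=
  Polynomial.sum_add_index p q (fun n a => (RatFunc.X ^ n : RatFunc K) ⊗ₜ[K] a) (by simp)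
    (by simp [TensorProduct.tmul_add])

lemma valuedPoly_monomial (n : ℕ) (a : A) :
    valuedPoly (K := K) (Polynomial.monomial n a) = (RatFunc.X ^ n : RatFunc K) ⊗ₜ[K] a :=
  Polynomial.sum_monomial_index a (fun n a => (RatFunc.X ^ n : RatFunc K) ⊗ₜ[K] a) (by simp)

lemma exists_valuedPoly {x : RatFunc K ⊗[K] A} (hx : x ∈ polySub K A) :
    ∃ p : A[X], valuedPoly p = x := by
  obtain ⟨y, rfl⟩ := hx
  induction y using TensorProduct.induction_on with
  | zero => exact ⟨0, by simp [valuedPoly]⟩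
  | add y y' hy hy' =>
    obtain ⟨p, hp⟩ := hy
    obtain ⟨p', hp'⟩ := hy'
    exact ⟨p + p', by rw [valuedPoly_add, hp, hp', map_add]⟩
  | tmul q a =>
    induction q using Polynomial.induction_on' with
    | add q q' hq hq' =>
      obtain ⟨p, hp⟩ := hq
      obtain ⟨p', hp'⟩ := hq'
      exact ⟨p + p', by rw [valuedPoly_add, hp, hp', TensorProduct.add_tmul, map_add]⟩
    | monomial n c =>
      refine ⟨Polynomial.monomial n (c • a), ?_⟩
      rw [valuedPoly_monomial, ← TensorProduct.smul_tmul]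
      simp [← Polynomial.C_mul_X_pow_eq_monomial, Algebra.smul_def, RatFunc.algebraMap_X]

lemma ratDeriv_algebraMap (q : K[X]) :
    ratDeriv K (algebraMap K[X] (RatFunc K) q) =
      algebraMap K[X] (RatFunc K) (Polynomial.derivative q) := by
  have := ratDeriv_div K q 1 one_ne_zero
  simpa using this

lemma deriv_mem_polySub {x : RatFunc K ⊗[K] A} (hx : x ∈ polySub K A) :
    (valuedDeriv K A).toAddMonoidHom x ∈ polySub K A := by
  obtain ⟨y, rfl⟩ := hx
  induction y using TensorProduct.induction_on with
  | zero => simp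
  | add y y' hy hy' => rw [map_add, map_add]; exact add_mem hy hy'
  | tmul q a =>
    have : (valuedDeriv K A).toAddMonoidHom ((algebraMap K[X] (RatFunc K) q) ⊗ₜ[K] a) =
        (ratDeriv K (algebraMap K[X] (RatFunc K) q)) ⊗ₜ[K] a := rfl
    simp only [AlgHom.toRingHom_eq_coe, RingHom.coe_coe, Algebra.TensorProduct.map_tmul,
      IsScalarTower.coe_toAlgHom', AlgHom.coe_id, id_eq]
    rw [this, ratDeriv_algebraMap]
    exact tmul_mem_polySub _ _

/-- Operators of order at most `k` whose coefficient of `∂^b` becomes a polynomial after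
multiplication by `w^(k-b)`. -/
def poleFiltration (w : K[X]) (k : ℕ) : AddSubgroup (DiffOp K A) where
  carrier := {P | (∀ b j, b + j = k → ((algebraMap K[X] (RatFunc K) (w ^ j)) ⊗ₜ[K] (1 : A)) *
    OreRing.coeff _ P b ∈ polySub K A) ∧ ∀ b, k < b → OreRing.coeff _ P b = 0}
  zero_mem' := ⟨fun b j _ => by
    change _ * (0 : RatFunc K ⊗[K] A) ∈ _
    simp, fun b _ => rfl⟩
  add_mem' {P Q} hP hQ := ⟨fun b j h => by
    rw [OreRing.coeff_add, mul_add]; exact add_mem (hP.1 b j h) (hQ.1 b j h), fun b h => by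
    rw [OreRing.coeff_add, hP.2 b h, hQ.2 b h, add_zero]⟩
  neg_mem' {P} hP := by
    have hn : ∀ b, OreRing.coeff _ (-P) b = - OreRing.coeff _ P b := fun b =>
      Polynomial.coeff_neg (R := RatFunc K ⊗[K] A) P b
    exact ⟨fun b j h => by rw [hn, mul_neg]; exact neg_mem (hP.1 b j h), fun b h => by
      rw [hn, hP.2 b h, neg_zero]⟩

lemma C_mul_mem_poleFiltration {w : K[X]} {k : ℕ} {P : DiffOp K A} {f : RatFunc K} {a : A}
    (hf : ∃ q, algebraMap K[X] (RatFunc K) w * f = algebraMap K[X] (RatFunc K) q)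
    (hP : P ∈ poleFiltration w k) :
    OreRing.C (valuedDeriv K A) (f ⊗ₜ[K] a) * P ∈ poleFiltration w (k + 1) := by
  obtain ⟨q, hq⟩ := hf
  refine ⟨fun b j h => ?_, fun b h => ?_⟩
  · rw [OreRing.coeff_C_mul]
    rcases j with _ | j
    · rw [hP.2 b (by omega)]; simp
    · have e : ((algebraMap K[X] (RatFunc K) (w ^ (j + 1))) ⊗ₜ[K] (1 : A)) * (f ⊗ₜ[K] a) =
          ((algebraMap K[X] (RatFunc K) q) ⊗ₜ[K] a) *
            ((algebraMap K[X] (RatFunc K) (w ^ j)) ⊗ₜ[K] (1 : A)) := by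
        simp only [Algebra.TensorProduct.tmul_mul_tmul, one_mul, mul_one]
        rw [← hq, pow_succ, map_mul]
        congr 1
        ring
      rw [← mul_assoc, e, mul_assoc]
      exact mul_mem (tmul_mem_polySub _ _) (hP.1 b j (by omega))
  · rw [OreRing.coeff_C_mul, hP.2 b (by omega), mul_zero]

lemma D_mul_mem_poleFiltration {w : K[X]} {k : ℕ} {P : DiffOp K A}
    (hP : P ∈ poleFiltration w k) :
    OreRing.D (valuedDeriv K A) * P ∈ poleFiltration w (k + 1) := by
  have hd : ∀ b j, b + j = k + 1 → ((algebraMap K[X] (RatFunc K) (w ^ j)) ⊗ₜ[K] (1 : A)) *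
      (valuedDeriv K A).toAddMonoidHom (OreRing.coeff _ P b) ∈ polySub K A := by
    intro b j h
    rcases j with _ | j
    · rw [hP.2 b (by omega), map_zero, mul_zero]; exact zero_mem _
    · have h1 := hP.1 b j (by omega)
      have hl : (valuedDeriv K A).toAddMonoidHom
          (((algebraMap K[X] (RatFunc K) (w ^ (j + 1))) ⊗ₜ[K] (1 : A)) *
            OreRing.coeff _ P b) =
          ((algebraMap K[X] (RatFunc K) (Polynomial.derivative (w ^ (j + 1)))) ⊗ₜ[K] (1 : A)) *
            OreRing.coeff _ P b +
          ((algebraMap K[X] (RatFunc K) (w ^ (j + 1))) ⊗ₜ[K] (1 : A)) *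
            (valuedDeriv K A).toAddMonoidHom (OreRing.coeff _ P b) := by
        refine ((valuedDeriv K A).leibniz' _ _).trans ?_
        rw [← ratDeriv_algebraMap]
        rfl
      have e1 : ∀ q : K[X], ((algebraMap K[X] (RatFunc K) (q * w ^ j)) ⊗ₜ[K] (1 : A)) *
          OreRing.coeff _ P b ∈ polySub K A := by
        intro q
        have : ((algebraMap K[X] (RatFunc K) (q * w ^ j)) ⊗ₜ[K] (1 : A)) =
            ((algebraMap K[X] (RatFunc K) q) ⊗ₜ[K] (1 : A)) *
            ((algebraMap K[X] (RatFunc K) (w ^ j)) ⊗ₜ[K] (1 : A)) := by simp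
        rw [this, mul_assoc]
        exact mul_mem (tmul_mem_polySub _ _) h1
      rw [← sub_eq_iff_eq_add'] at hl
      rw [← hl]
      refine sub_mem (deriv_mem_polySub ?_) ?_
      · rw [pow_succ']; exact e1 w
      · rw [Polynomial.derivative_pow_succ, mul_right_comm]; exact e1 _
  refine ⟨fun b j h => ?_, fun b h => ?_⟩
  · rcases b with _ | b
    · rw [OreRing.coeff_D_mul_zero]; exact hd _ _ h
    · rw [OreRing.coeff_D_mul_succ, mul_add]
      exact add_mem (hP.1 b j (by omega)) (hd _ _ h)
  · rcases b with _ | b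
    · omega
    · rw [OreRing.coeff_D_mul_succ, hP.2 b (by omega), hP.2 (b + 1) (by omega), map_zero, add_zero]

lemma gaudinMatrix_mul_mem {M N : ℕ} (z : Fin N → K) (lam : Fin M → K)
    (e : Fin N → Fin M → Fin M → A) (i j : Fin M) {k : ℕ} {P : DiffOp K A}
    (hP : P ∈ poleFiltration (∏ a, (Polynomial.X - Polynomial.C (z a))) k) :
    gaudinMatrix z lam e i j * P ∈
      poleFiltration (∏ a, (Polynomial.X - Polynomial.C (z a))) (k + 1) := by
  unfold gaudinMatrix
  rw [Matrix.of_apply, sub_mul, Finset.sum_mul]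
  refine sub_mem ?_ (sum_mem fun a _ => ?_)
  · split_ifs
    · rw [sub_mul]
      refine sub_mem (D_mul_mem_poleFiltration hP) (C_mul_mem_poleFiltration ?_ hP)
      exact ⟨(∏ a, (Polynomial.X - Polynomial.C (z a))) * Polynomial.C (lam i), by simp⟩
    · rw [zero_mul]; exact zero_mem _
  · have e1 : DiffOp.scalar A (uSub (z a))⁻¹ * DiffOp.const (e a j i) =
        OreRing.C (valuedDeriv K A) ((uSub (z a))⁻¹ ⊗ₜ[K] (e a j i)) := by
      refine (OreRing.C_mul_C _ _ _).trans ?_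
      simp
    rw [e1]
    refine C_mul_mem_poleFiltration
      ⟨∏ b ∈ Finset.univ.erase a, (Polynomial.X - Polynomial.C (z b)), ?_⟩ hP
    have h0 : algebraMap K[X] (RatFunc K) (Polynomial.X - Polynomial.C (z a)) ≠ 0 :=
      RatFunc.algebraMap_ne_zero (Polynomial.X_sub_C_ne_zero _)
    have h1 : uSub (z a) = algebraMap K[X] (RatFunc K) (Polynomial.X - Polynomial.C (z a)) := by
      simp [uSub]
    rw [← Finset.mul_prod_erase _ _ (Finset.mem_univ a), h1, map_mul]
    field_simp

lemma rdet_gaudinMatrix_mem {M N : ℕ} (z : Fin N → K) (lam : Fin M → K)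
    (e : Fin N → Fin M → Fin M → A) :
    rdet (gaudinMatrix z lam e) ∈
      poleFiltration (∏ a, (Polynomial.X - Polynomial.C (z a))) M := by
  refine sum_mem fun σ _ => zsmul_mem ?_ _
  have key : ∀ l : List (Fin M × Fin M), (l.map fun x => gaudinMatrix z lam e x.1 x.2).prod ∈
      poleFiltration (∏ a, (Polynomial.X - Polynomial.C (z a))) l.length := by
    intro l
    induction l with
    | nil =>
      have h0 : OreRing.coeff (valuedDeriv K A) 1 0 = 1 := Polynomial.coeff_one_zero
      refine ⟨fun b j h => ?_, fun b h => ?_⟩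
      · obtain ⟨rfl, rfl⟩ : b = 0 ∧ j = 0 := by
          rw [List.length_nil] at h; omega
        rw [List.map_nil, List.prod_nil, h0, mul_one]
        exact tmul_mem_polySub _ _
      · rw [List.map_nil, List.prod_nil]
        refine (Polynomial.coeff_one (R := RatFunc K ⊗[K] A)).trans (if_neg ?_)
        rw [List.length_nil] at h; omega
    | cons x l ih =>
      rw [List.map_cons, List.prod_cons, List.length_cons]
      exact gaudinMatrix_mul_mem _ _ _ _ _ ih
  have := key (List.ofFn fun i => (i, σ i))
  rw [List.length_ofFn, List.map_ofFn] at this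
  exact this

/-- The functions `∏_a (u - z_a)^i · G̃_i(M, N, z, λ, u)` are polynomials in `u`. -/
lemma exists_transferMatrix_polynomial (M N : ℕ) (z : Fin N → K) (lam : Fin M → K) (i : ℕ)
    (hi : i ≤ M) : ∃ p : (UglTensor K M N)[X],
      valuedPoly p = ((∏ a, uSub (z a) ^ i) ⊗ₜ[K] (1 : UglTensor K M N)) *
        transferMatrix M N z lam i := by
  apply exists_valuedPoly
  have h := (rdet_gaudinMatrix_mem z lam (glE K M N)).1 (M - i) i (by omega)
  have e : (algebraMap K[X] (RatFunc K)) ((∏ a, (Polynomial.X - Polynomial.C (z a))) ^ i) =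
      ∏ a, uSub (z a) ^ i := by
    simp [uSub, Finset.prod_pow]
  rw [e] at h
  exact h

end Polynomiality

/-! ### The actions on polynomials -/

variable (K) in
/-- The operator `x_s ∂/∂x_t` on polynomials. -/
def xPartial {σ : Type*} (s t : σ) : Module.End K (MvPolynomial σ K) :=
  LinearMap.mulLeft K (MvPolynomial.X s) ∘ₗ (MvPolynomial.pderiv t).toLinearMap

lemma xPartial_lie {σ : Type*} [DecidableEq σ] (s t s' t' : σ) :
    ⁅xPartial K s t, xPartial K s' t'⁆ =
      (if t = s' then xPartial K s t' else 0) - (if t' = s then xPartial K s' t else 0) := by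
  have hx : ∀ a b : σ, xPartial K a b = ((MvPolynomial.X a : MvPolynomial σ K) •
      (MvPolynomial.pderiv b : Derivation K (MvPolynomial σ K) (MvPolynomial σ K)) :
      Derivation K (MvPolynomial σ K) (MvPolynomial σ K)).toLinearMap := fun a b => rfl
  have key : ⁅(MvPolynomial.X s : MvPolynomial σ K) • (MvPolynomial.pderiv t :
        Derivation K (MvPolynomial σ K) (MvPolynomial σ K)),
      (MvPolynomial.X s' : MvPolynomial σ K) • (MvPolynomial.pderiv t' :
        Derivation K (MvPolynomial σ K) (MvPolynomial σ K))⁆ =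
      (if t = s' then (MvPolynomial.X s : MvPolynomial σ K) • (MvPolynomial.pderiv t' :
        Derivation K (MvPolynomial σ K) (MvPolynomial σ K)) else 0) -
      (if t' = s then (MvPolynomial.X s' : MvPolynomial σ K) • (MvPolynomial.pderiv t :
        Derivation K (MvPolynomial σ K) (MvPolynomial σ K)) else 0) := by
    refine MvPolynomial.derivation_ext fun r => ?_
    rw [Derivation.commutator_apply]
    by_cases h1 : t = s' <;> by_cases h2 : t' = s <;> by_cases h3 : r = t <;>
      by_cases h4 : r = t' <;>
      simp_all [MvPolynomial.pderiv_X, Pi.single_apply, eq_comm]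
  have := congrArg (fun d : Derivation K (MvPolynomial σ K) (MvPolynomial σ K) =>
    (d : Module.End K (MvPolynomial σ K))) key
  simp only [Derivation.commutator_coe_linear_map] at this
  rw [hx, hx]
  refine this.trans ?_
  split_ifs <;> rfl

/-- For variables `x_{s_1}, …, x_{s_m}`, the linear map from matrices to operators on polynomials
with `E_ij ↦ x_{s_i} ∂/∂x_{s_j}`. -/
def glLin {σ : Type*} {m : ℕ} (s : Fin m → σ) :
    Matrix (Fin m) (Fin m) K →ₗ[K] Module.End K (MvPolynomial σ K) where
  toFun B := ∑ i, ∑ j, B i j • xPartial K (s i) (s j)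
  map_add' B B' := by simp [add_smul, Finset.sum_add_distrib]
  map_smul' c B := by simp [mul_smul, Finset.smul_sum]

lemma glLin_single {σ : Type*} {m : ℕ} (s : Fin m → σ) (i j : Fin m) (c : K) :
    glLin s (Matrix.single i j c) = c • xPartial K (s i) (s j) := by
  change ∑ i', ∑ j', Matrix.single i j c i' j' • xPartial K (s i') (s j') = _
  simp [Matrix.single_apply, ite_and]

lemma glLin_lie {σ : Type*} {m : ℕ} (s : Fin m ↪ σ) (B B' : Matrix (Fin m) (Fin m) K) :
    glLin s (B * B' - B' * B) = glLin s B * glLin s B' - glLin s B' * glLin s B := by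
  classical
  induction B using Matrix.induction_on' with
  | h_zero => simp
  | h_add p q hp hq =>
    rw [show (p + q) * B' - B' * (p + q) = (p * B' - B' * p) + (q * B' - B' * q) by
      noncomm_ring, map_add, hp, hq, map_add]
    noncomm_ring
  | h_std_basis i j a =>
    induction B' using Matrix.induction_on' with
    | h_zero => simp
    | h_add p q hp hq =>
      rw [mul_add, add_mul, add_sub_add_comm, map_add, hp, hq, map_add, mul_add, add_mul,
        add_sub_add_comm]
    | h_std_basis k l b =>
      have h := xPartial_lie (K := K) (s i) (s j) (s k) (s l)
      rw [LieRing.of_associative_ring_bracket] at h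
      simp only [s.injective.eq_iff] at h
      rw [glLin_single, glLin_single, smul_mul_smul_comm, smul_mul_smul_comm, mul_comm b a]
      refine Eq.trans ?_ (smul_sub (a * b) _ _)
      rw [h, map_sub, smul_sub]
      congr 1
      · by_cases hjk : j = k
        · subst hjk; simp [glLin_single]
        · simp [hjk]
      · by_cases hli : l = i
        · subst hli; simp [glLin_single, mul_comm]
        · simp [hli]

/-- For distinct variables `x_{s_1}, …, x_{s_m}`, the action `E_ij ↦ x_{s_i} ∂/∂x_{s_j}` of the
Lie algebra `gl_m` on polynomials. -/
def glRep {σ : Type*} {m : ℕ} (s : Fin m ↪ σ) :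
    Matrix (Fin m) (Fin m) K →ₗ⁅K⁆ Module.End K (MvPolynomial σ K) where
  __ := glLin s
  map_lie' {B B'} := glLin_lie s B B'

/-- The extension of `glRep` to the universal enveloping algebra. -/
def uglRep {σ : Type*} {m : ℕ} (s : Fin m ↪ σ) :
    Ugl K m →ₐ[K] Module.End K (MvPolynomial σ K) :=
  UniversalEnvelopingAlgebra.lift K (glRep s)

lemma glRep_single {σ : Type*} {m : ℕ} (s : Fin m ↪ σ) (i j : Fin m) :
    glRep s (Matrix.single i j (1 : K)) = xPartial K (s i) (s j) :=
  (glLin_single s i j 1).trans (one_smul _ _)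

lemma commute_xPartial {σ : Type*} {s t s' t' : σ} (h : t ≠ s') (h' : t' ≠ s) :
    Commute (xPartial K s t) (xPartial K s' t') := by
  classical
  have := xPartial_lie (K := K) s t s' t'
  rw [if_neg h, if_neg h', sub_zero, LieRing.of_associative_ring_bracket, sub_eq_zero] at this
  exact this

/-- An element that commutes with the action of the Lie algebra commutes with the action of its
universal enveloping algebra. -/
lemma commute_uglRep {σ : Type*} {m : ℕ} (s : Fin m ↪ σ) (y : Module.End K (MvPolynomial σ K))
    (h : ∀ i j, Commute y (xPartial K (s i) (s j))) (x : Ugl K m) : Commute y (uglRep s x) := by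
  have hB : ∀ B, glRep s B ∈ Subalgebra.centralizer K {y} := by
    intro B
    rw [Subalgebra.mem_centralizer_iff]
    rintro _ rfl
    refine Commute.sum_right _ _ _ fun i _ => Commute.sum_right _ _ _ fun j _ => ?_
    exact (h i j).smul_right _
  let g : Matrix (Fin m) (Fin m) K →ₗ⁅K⁆ Subalgebra.centralizer K {y} :=
    { toFun := fun B => ⟨glRep s B, hB B⟩
      map_add' := fun B B' => Subtype.ext (map_add (glRep s) B B')
      map_smul' := fun c B => Subtype.ext (map_smul (glRep s) c B)
      map_lie' := fun {B B'} => Subtype.ext (LieHom.map_lie (glRep s) B B') }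
  have hg : (Subalgebra.centralizer K {y}).val.comp (UniversalEnvelopingAlgebra.lift K g) =
      uglRep s := by
    apply UniversalEnvelopingAlgebra.hom_ext
    ext1 B
    simp [uglRep, g]
  have := (UniversalEnvelopingAlgebra.lift K g x).2
  rw [Subalgebra.mem_centralizer_iff] at this
  have h2 := this y rfl
  rw [← hg]
  exact h2

lemma prod_ofFn_mul {S : Type*} [Monoid S] {n : ℕ} (x y : Fin n → S)
    (h : ∀ i j, i ≠ j → Commute (x i) (y j)) :
    (List.ofFn fun i => x i * y i).prod = (List.ofFn x).prod * (List.ofFn y).prod := by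
  induction n with
  | zero => simp
  | succ n ih =>
    simp only [List.ofFn_succ, List.prod_cons]
    rw [ih (fun i => x i.succ) (fun i => y i.succ)
      fun i j hij => h _ _ fun e => hij (Fin.succ_injective _ e)]
    have hc : Commute (y 0) (List.ofFn fun i : Fin n => x i.succ).prod := by
      refine Commute.list_prod_right _ _ fun w hw => ?_
      obtain ⟨i, rfl⟩ := (List.mem_ofFn' _ _).1 hw
      exact (h i.succ 0 (Fin.succ_ne_zero i)).symm
    simp only [mul_assoc]
    congr 1
    rw [← mul_assoc, ← mul_assoc, hc.eq]

lemma prod_ofFn_single {S : Type*} [Monoid S] {n : ℕ} (a : Fin n) (y : Fin n → S)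
    (h : ∀ b, b ≠ a → y b = 1) : (List.ofFn y).prod = y a := by
  induction n with
  | zero => exact a.elim0
  | succ n ih =>
    rw [List.ofFn_succ, List.prod_cons]
    induction a using Fin.cases with
    | zero =>
      have : (fun i : Fin n => y i.succ) = fun _ => 1 :=
        funext fun i => h _ (Fin.succ_ne_zero i)
      simp [this]
    | succ a =>
      rw [h 0 (Fin.succ_ne_zero a).symm, one_mul]
      exact ih a _ fun b hb => h _ fun e => hb (Fin.succ_injective _ e)

/-- For injections `i ↦ s_{a,i}` with disjoint images, the algebra homomorphism
`(U gl_m)^{⊗ n} → End K[x]` under which the `a`-th factor acts by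
`E_ij ↦ x_{s_{a,i}} ∂/∂x_{s_{a,j}}`. -/
def tensorRep {σ : Type*} {m n : ℕ} (s : Fin n → Fin m ↪ σ)
    (hs : ∀ a b i j, a ≠ b → s a i ≠ s b j) :
    UglTensor K m n →ₐ[K] Module.End K (MvPolynomial σ K) :=
  PiTensorProduct.liftAlgHom
    ((MultilinearMap.mkPiAlgebraFin K n (Module.End K (MvPolynomial σ K))).compLinearMap
      fun a => (uglRep (s a)).toLinearMap)
    (by simp [Pi.one_def])
    (by
      intro x y
      simp only [MultilinearMap.compLinearMap_apply, MultilinearMap.mkPiAlgebraFin_apply,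
        AlgHom.toLinearMap_apply, Pi.mul_apply, map_mul]
      refine prod_ofFn_mul _ _ fun a b hab => ?_
      refine commute_uglRep _ _ (fun i j => Commute.symm ?_) _
      refine commute_uglRep _ _ (fun k l => ?_) _
      exact commute_xPartial (hs _ _ _ _ hab.symm) (hs _ _ _ _ hab))

lemma tensorRep_glE {σ : Type*} {m n : ℕ} (s : Fin n → Fin m ↪ σ)
    (hs : ∀ a b i j, a ≠ b → s a i ≠ s b j) (a : Fin n) (i j : Fin m) :
    tensorRep s hs (glE K m n a i j) = xPartial K (s a i) (s a j) := by
  unfold tensorRep glE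
  rw [PiTensorProduct.singleAlgHom_apply, PiTensorProduct.liftAlgHom_apply,
    PiTensorProduct.lift.tprod, MultilinearMap.compLinearMap_apply,
    MultilinearMap.mkPiAlgebraFin_apply, prod_ofFn_single a]
  · simp [uglRep, glRep_single]
  · intro b hb
    simp [Pi.mulSingle_eq_of_ne hb]

variable (K)

/-- The homomorphism `π^{(M)} : (U gl_M)^{⊗ N} → End K[x_{ij}]`, `E_ij^{(a)} ↦ x_ia ∂/∂x_ja`. -/
def piM (M N : ℕ) :
    UglTensor K M N →ₐ[K] Module.End K (MvPolynomial (Fin M × Fin N) K) :=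
  tensorRep (fun a => ⟨fun i => (i, a), fun _ _ h => congrArg Prod.fst h⟩)
    fun _ _ _ _ hab h => hab (congrArg Prod.snd h)

/-- The homomorphism `π^{(N)} : (U gl_N)^{⊗ M} → End K[x_{ij}]`, `E_ij^{(a)} ↦ x_ai ∂/∂x_aj`. -/
def piN (M N : ℕ) :
    UglTensor K N M →ₐ[K] Module.End K (MvPolynomial (Fin M × Fin N) K) :=
  tensorRep (fun a => ⟨fun i => (a, i), fun _ _ h => congrArg Prod.snd h⟩)
    fun _ _ _ _ hab h => hab (congrArg Prod.fst h)

lemma piM_glE (M N : ℕ) (a : Fin N) (i j : Fin M) :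
    piM K M N (glE K M N a i j) = xPartial K (i, a) (j, a) :=
  tensorRep_glE _ _ a i j

lemma piN_glE (M N : ℕ) (a : Fin M) (i j : Fin N) :
    piN K M N (glE K N M a i j) = xPartial K (a, i) (a, j) :=
  tensorRep_glE _ _ a i j

end Bethe

end

/-! Replace `x_{ia}`, `∂/∂x_{ia}` and `∂/∂u` by commuting symbols `x_{ia}`, `p_{ia}` and `v`. The
Gaudin matrix becomes `(v - λ_i) δ_ij - ∑_a x_{ja} p_{ia} / (u - z_a)`. This is the Schur complement
of the block `u - z` in a matrix with diagonal blocks `u - z`, `v - λ` and off-diagonal blocks `xᵀ`,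
`p`. So `∏_a (u - z_a)` times its determinant is the block determinant, a polynomial in `u` and `v`.
Exchanging the roles of `(u, z)` and `(v, λ)` only permutes the blocks and transposes the matrix, so
the duality is evident for symbols (`map_det_blockSymbol`, `swap_det_blockSymbol`).

What has to be proved is that nothing is lost in passing to symbols: the noncommutative row
determinant is exactly the normally ordered commutative determinant, with all `x` on the left and
all `∂` on the right, without correction terms (`Grassmann.map_det_capelliMatrix`). A row
determinant is the product of the linear forms `η_i` of the rows in Grassmann variables `ψ_j`
(`Grassmann.prod_rowForm`). Here `η_i = (∂_u - λ_i) ψ_i - ∑_a Y_a ∂/∂x_{ia}` with `Y_a = ∑_j x_{ja}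
ψ_j / (u - z_a)`. The correction from `[∂/∂x_{ia}, x_{ia}] = 1` cancels against the one from the
`u`-derivative of `1 / (u - z_a)`, so `η_i` and `Y_a` anticommute (`Grassmann.rowForm_mul_colForm`).
Hence every `Y_a` can be carried to the far left of the product at the cost of a sign, the same sign
as for commuting symbols.

The operators `A_ab` are therefore the normally ordered coefficients of `u^a v^b` in the block
determinant, and the dual side gives the same operators. The two Bethe subalgebras have the same
image because each image is generated by the `A_ab`: extra powers of `∏_a (u - z_a)` have scalar
coefficients and are monic, so they can be divided out (`map_betheSubalgebra`). -/

/-! ### Row determinants and Grassmann variables -/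

/-- The Grassmann algebra over `ℤ` in `n` generators. -/
abbrev Grassmann (n : ℕ) : Type := ExteriorAlgebra ℤ (Fin n → ℤ)

namespace Grassmann

variable {n : ℕ}

/-- The `j`-th generator of the Grassmann algebra. -/
noncomputable def gen (j : Fin n) : Grassmann n := ExteriorAlgebra.ι ℤ (Pi.single j 1)

lemma gen_mul_swap (i j : Fin n) : gen i * gen j = -(gen j * gen i) :=
  eq_neg_of_add_eq_zero_left (ExteriorAlgebra.ι_add_mul_swap _ _)

/-- The coefficient of the product of all generators. -/
noncomputable def berezin (n : ℕ) : Grassmann n →ₗ[ℤ] ℤ :=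
  ExteriorAlgebra.liftAlternating (Pi.single n Matrix.detRowAlternating)

lemma prod_gen (f : Fin n → Fin n) : (List.ofFn fun i => gen (f i)).prod =
    ExteriorAlgebra.ιMulti ℤ n fun i => (Pi.single (f i) 1 : Fin n → ℤ) :=
  (ExteriorAlgebra.ιMulti_apply _).symm

/-- This makes it possible to recover `s` from `s ⊗ ψ_1 ⋯ ψ_n`, and so to read off a row determinant
from a product of row forms. -/
lemma berezin_prod_gen : berezin n (List.ofFn (gen (n := n))).prod = 1 := by
  have h := prod_gen (n := n) id
  simp only [id] at h
  rw [h, berezin, ExteriorAlgebra.liftAlternating_apply_ιMulti, Pi.single_eq_same]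
  have : (fun i : Fin n => (Pi.single i 1 : Fin n → ℤ)) = (1 : Matrix (Fin n) (Fin n) ℤ) := by
    ext i j
    simp [Matrix.one_apply, Pi.single_apply, eq_comm]
  rw [this]
  exact Matrix.det_one

variable {S : Type*} [Ring S]

/-- The linear form in the Grassmann variables with coefficients in the `i`-th row of a matrix. -/
noncomputable def rowForm (a : Matrix (Fin n) (Fin n) S) (i : Fin n) : S ⊗[ℤ] Grassmann n :=
  ∑ j, a i j ⊗ₜ gen j

lemma prod_ofFn_tmul {m : ℕ} {E : Type*} [Ring E] (x : Fin m → S) (y : Fin m → E) :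
    (List.ofFn fun i => x i ⊗ₜ[ℤ] y i).prod = (List.ofFn x).prod ⊗ₜ[ℤ] (List.ofFn y).prod := by
  induction m with
  | zero => simp [Algebra.TensorProduct.one_def]
  | succ m ih => simp [List.ofFn_succ, ih]

/-- The product of the row forms of a matrix is its row determinant times the product of the
Grassmann variables. -/
lemma prod_rowForm (a : Matrix (Fin n) (Fin n) S) :
    (List.ofFn (rowForm a)).prod = rdet a ⊗ₜ[ℤ] (List.ofFn (gen (n := n))).prod := by
  have h := MultilinearMap.map_sum (MultilinearMap.mkPiAlgebraFin ℤ n (S ⊗[ℤ] Grassmann n))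
    (fun i j : Fin n => a i j ⊗ₜ[ℤ] gen j)
  simp only [MultilinearMap.mkPiAlgebraFin_apply, prod_ofFn_tmul] at h
  refine h.trans ?_
  rw [rdet, TensorProduct.sum_tmul]
  symm
  -- The product expands over all functions `f`. Those that are not injective repeat a Grassmann
  -- variable and contribute zero; permutations contribute their sign.
  refine Finset.sum_of_injOn (fun σ : Equiv.Perm (Fin n) => (σ : Fin n → Fin n))
    (fun _ _ _ _ h => DFunLike.coe_injective h) (fun _ _ => Finset.mem_coe.2 (Finset.mem_univ _))
    ?_ ?_
  · intro f _ hf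
    have hinj : ¬ Function.Injective f := fun hinj =>
      hf ⟨Equiv.ofBijective f (Finite.injective_iff_bijective.1 hinj), by simp, rfl⟩
    simp only [Function.Injective, not_forall] at hinj
    obtain ⟨i, j, hij, hne⟩ := hinj
    rw [prod_gen, AlternatingMap.map_eq_zero_of_eq _ _ (by rw [hij]) hne, TensorProduct.tmul_zero]
  · intro σ _
    have h1 := prod_gen (n := n) id
    simp only [id] at h1
    have h2 := AlternatingMap.map_perm (ExteriorAlgebra.ιMulti ℤ n (M := Fin n → ℤ))
      (fun i => (Pi.single i 1 : Fin n → ℤ)) σ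
    simp only [Function.comp_def] at h2
    change ((Equiv.Perm.sign σ : ℤ) • (List.ofFn fun i => a i (σ i)).prod) ⊗ₜ[ℤ]
      (List.ofFn fun i => gen i).prod =
        (List.ofFn fun i => a i (σ i)).prod ⊗ₜ[ℤ] (List.ofFn fun i => gen (σ i)).prod
    rw [prod_gen σ, h1, h2, TensorProduct.smul_tmul]
    rfl

end Grassmann

/-- `Matrix.det_apply` has factors `a (σ i) i` rather than `a i (σ i)`, hence the transpose. -/
lemma rdet_eq_det {C : Type*} [CommRing C] {n : ℕ} (a : Matrix (Fin n) (Fin n) C) :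
    rdet a = a.det := by
  rw [← Matrix.det_transpose, Matrix.det_apply, rdet]
  refine Finset.sum_congr rfl fun σ _ => ?_
  rw [List.prod_ofFn]
  simp [Units.smul_def]

/-! ### Capelli matrices: absence of corrections to normal ordering -/

namespace Grassmann

variable {n : ℕ} {ι S : Type*} [Ring S]

/-- The linear form `∑_j y_aj ψ_j` in the Grassmann variables `ψ_j`. -/
noncomputable def colForm (y : ι → Fin n → S) (a : ι) : S ⊗[ℤ] Grassmann n :=
  ∑ j, y a j ⊗ₜ gen j

/-- The coefficients commute and the Grassmann variables anticommute. -/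
lemma colForm_mul_swap (y : ι → Fin n → S) (hy : ∀ a j b k, y a j * y b k = y b k * y a j)
    (a b : ι) : colForm y a * colForm y b = -(colForm y b * colForm y a) := by
  simp only [colForm, Finset.sum_mul_sum, Algebra.TensorProduct.tmul_mul_tmul,
    ← Finset.sum_neg_distrib]
  rw [Finset.sum_comm]
  refine Finset.sum_congr rfl fun k _ => Finset.sum_congr rfl fun j _ => ?_
  rw [gen_mul_swap, TensorProduct.tmul_neg, hy]

variable [Fintype ι]

/-- The matrix `d_i δ_ij - ∑_a y_aj p_ia`. -/
def capelliMatrix (d : Fin n → S) (y : ι → Fin n → S) (p : Fin n → ι → S) :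
    Matrix (Fin n) (Fin n) S :=
  Matrix.of fun i j => (if i = j then d i else 0) - ∑ a, y a j * p i a

lemma rowForm_capelliMatrix (d : Fin n → S) (y : ι → Fin n → S) (p : Fin n → ι → S) (i : Fin n) :
    rowForm (capelliMatrix d y p) i =
      d i ⊗ₜ gen i - ∑ a, colForm y a * (p i a ⊗ₜ 1) := by
  simp only [rowForm, capelliMatrix, Matrix.of_apply, TensorProduct.sub_tmul,
    Finset.sum_sub_distrib, colForm, Finset.sum_mul, Algebra.TensorProduct.tmul_mul_tmul, mul_one,
    TensorProduct.sum_tmul]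
  congr 1
  · rw [Finset.sum_eq_single i]
    · simp
    · intro j _ hj
      rw [if_neg (Ne.symm hj), TensorProduct.zero_tmul]
    · simp
  · exact Finset.sum_comm

/-- If `[p_ib, y_aj] = δ_ab δ_ij f_a` and `[d_i, y_aj] = - f_a y_aj`, the row forms of the matrix
`d_i δ_ij - ∑_a y_aj p_ia` anticommute with the forms `∑_j y_aj ψ_j`. -/
lemma rowForm_mul_colForm [DecidableEq ι] (d : Fin n → S) (y : ι → Fin n → S)
    (p : Fin n → ι → S) (f : ι → S)
    (hy : ∀ a j b k, y a j * y b k = y b k * y a j)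
    (hp : ∀ i b a j, p i b * y a j = y a j * p i b + if a = b ∧ i = j then f a else 0)
    (hd : ∀ i a j, d i * y a j = y a j * d i - f a * y a j)
    (hf : ∀ a j, f a * y a j = y a j * f a) (i : Fin n) (a : ι) :
    rowForm (capelliMatrix d y p) i * colForm y a =
      -(colForm y a * rowForm (capelliMatrix d y p) i) := by
  -- With `Y_a` the column form and `ψ_i` the generator, `[p_ib, Y_a] = δ_ab f_a ψ_i`: this is the
  -- first correction.
  have h1 : ∀ b, ((p i b) ⊗ₜ[ℤ] (1 : Grassmann n)) * colForm y a =
      colForm y a * ((p i b) ⊗ₜ 1) + if a = b then f a ⊗ₜ gen i else 0 := by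
    intro b
    simp only [colForm, Finset.sum_mul, Finset.mul_sum, Algebra.TensorProduct.tmul_mul_tmul,
      mul_one, one_mul, hp, TensorProduct.add_tmul, Finset.sum_add_distrib]
    congr 1
    split_ifs with h
    · rw [Finset.sum_eq_single i]
      · simp [h]
      · intro j _ hj
        rw [if_neg fun h => hj h.2.symm, TensorProduct.zero_tmul]
      · simp
    · simp [h]
  -- The second correction, `- f_a ψ_i Y_a`, comes from `[d_i, y_aj] = - f_a y_aj`. By `h3` and `h4`
  -- it cancels the first one.
  have h2 : (d i ⊗ₜ[ℤ] gen i) * colForm y a =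
      -(colForm y a * (d i ⊗ₜ gen i)) - (f a ⊗ₜ gen i) * colForm y a := by
    simp only [colForm, Finset.sum_mul, Finset.mul_sum, Algebra.TensorProduct.tmul_mul_tmul,
      hd, TensorProduct.sub_tmul, Finset.sum_sub_distrib]
    congr 1
    rw [← Finset.sum_neg_distrib]
    refine Finset.sum_congr rfl fun j _ => ?_
    rw [gen_mul_swap, TensorProduct.tmul_neg]
  have h3 : colForm y a * (f a ⊗ₜ gen i) = -((f a ⊗ₜ gen i) * colForm y a) := by
    simp only [colForm, Finset.sum_mul, Finset.mul_sum, Algebra.TensorProduct.tmul_mul_tmul,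
      ← Finset.sum_neg_distrib]
    refine Finset.sum_congr rfl fun j _ => ?_
    rw [gen_mul_swap, TensorProduct.tmul_neg, hf]
  have h4 : ∑ b, colForm y b * (if a = b then f a ⊗ₜ[ℤ] gen i else 0) =
      colForm y a * (f a ⊗ₜ gen i) := by
    rw [Finset.sum_eq_single a]
    · simp
    · intro b _ hb
      rw [if_neg (Ne.symm hb), mul_zero]
    · simp
  rw [rowForm_capelliMatrix, sub_mul, mul_sub, h2, Finset.sum_mul]
  simp only [mul_assoc, h1, mul_add, Finset.sum_add_distrib, h4, h3]
  have h5 : ∑ b, colForm y b * (colForm y a * (p i b ⊗ₜ[ℤ] 1)) =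
      -(colForm y a * ∑ b, colForm y b * (p i b ⊗ₜ[ℤ] 1)) := by
    rw [Finset.mul_sum, ← Finset.sum_neg_distrib]
    refine Finset.sum_congr rfl fun b _ => ?_
    rw [← mul_assoc, ← mul_assoc, colForm_mul_swap y hy]
    exact neg_mul (colForm y a * colForm y b) (p i b ⊗ₜ[ℤ] (1 : Grassmann n))
  rw [h5]
  abel

lemma prod_mul_of_anticommute {Γ : Type*} [Ring Γ] {κ : Type*} (η : κ → Γ) (w : Γ)
    (h : ∀ i, η i * w = -(w * η i)) (l : List κ) :
    (l.map η).prod * w = (-1) ^ l.length * (w * (l.map η).prod) := by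
  induction l with
  | nil => simp
  | cons i l ih =>
    rw [List.map_cons, List.prod_cons, mul_assoc, ih, List.length_cons, pow_succ,
      ← mul_assoc, ((Commute.neg_one_left (η i)).pow_left _).eq.symm, mul_assoc, ← mul_assoc (η i),
      h]
    noncomm_ring

lemma map_neg_one_pow_mul {Γ Γ' : Type*} [Ring Γ] [Ring Γ'] (Θ : Γ →+ Γ') (k : ℕ) (G : Γ) :
    Θ ((-1) ^ k * G) = (-1) ^ k * Θ G := by
  rcases Nat.even_or_odd k with hk | hk <;> simp [hk.neg_one_pow]

variable {C : Type*} [CommRing C]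

/-- The abstract Capelli identity: under a normal ordering map `θ`, which is compatible with left
multiplication by the `y_aj` and right multiplication by the `p_ia` and `d_i`, the determinant of
`d_i δ_ij - ∑_a y_aj p_ia` over a commutative ring goes to the row determinant. -/
theorem map_det_capelliMatrix [DecidableEq ι] (d : Fin n → S) (y : ι → Fin n → S)
    (p : Fin n → ι → S) (f : ι → S)
    (hy : ∀ a j b k, y a j * y b k = y b k * y a j)
    (hp : ∀ i b a j, p i b * y a j = y a j * p i b + if a = b ∧ i = j then f a else 0)
    (hd : ∀ i a j, d i * y a j = y a j * d i - f a * y a j)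
    (hf : ∀ a j, f a * y a j = y a j * f a)
    (d' : Fin n → C) (y' : ι → Fin n → C) (p' : Fin n → ι → C) (θ : C →+ S)
    (h1 : θ 1 = 1) (hθd : ∀ F i, θ (F * d' i) = θ F * d i)
    (hθ : ∀ F a j i, θ (y' a j * F * p' i a) = y a j * θ F * p i a) :
    θ (capelliMatrix d' y' p').det = rdet (capelliMatrix d y p) := by
  -- The normal ordering map, extended by the identity on Grassmann variables.
  let Θ : C ⊗[ℤ] Grassmann n →ₗ[ℤ] S ⊗[ℤ] Grassmann n :=
    TensorProduct.map θ.toIntLinearMap LinearMap.id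
  have hΘ : ∀ F ω, Θ (F ⊗ₜ ω) = θ F ⊗ₜ ω := fun F ω => TensorProduct.map_tmul _ _ _ _
  have hΘd : ∀ G i, Θ (G * (d' i ⊗ₜ gen i)) = Θ G * (d i ⊗ₜ gen i) := by
    intro G i
    induction G using TensorProduct.induction_on with
    | zero => simp
    | add G G' h h' => rw [add_mul, map_add, h, h', map_add, add_mul]
    | tmul F ω => simp only [Algebra.TensorProduct.tmul_mul_tmul, hΘ, hθd]
  have hΘp : ∀ G a i, Θ (colForm y' a * G * (p' i a ⊗ₜ 1)) =
      colForm y a * Θ G * (p i a ⊗ₜ 1) := by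
    intro G a i
    simp only [colForm, Finset.sum_mul, map_sum]
    refine Finset.sum_congr rfl fun j _ => ?_
    induction G using TensorProduct.induction_on with
    | zero => simp
    | add G G' h h' => rw [mul_add, add_mul, map_add, h, h', map_add, mul_add, add_mul]
    | tmul F ω => simp only [Algebra.TensorProduct.tmul_mul_tmul, hΘ, hθ]
  have hac := rowForm_mul_colForm d y p f hy hp hd hf
  -- In the commutative ring both commutators vanish, so the same lemma applies with `f = 0`.
  have hac' := rowForm_mul_colForm d' y' p' (fun _ => 0) (fun _ _ _ _ => mul_comm _ _)
    (fun _ _ _ _ => by rw [mul_comm]; simp) (fun _ _ _ => by rw [mul_comm]; simp)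
    (fun _ _ => mul_comm _ _)
  have hsign : ∀ (k : ℕ) (G : C ⊗[ℤ] Grassmann n), Θ ((-1) ^ k * G) = (-1) ^ k * Θ G := by
    exact fun k G => map_neg_one_pow_mul Θ.toAddMonoidHom k G
  have key : ∀ l : List (Fin n), Θ (l.map (rowForm (capelliMatrix d' y' p'))).prod =
      (l.map (rowForm (capelliMatrix d y p))).prod := by
    intro l
    -- Rows are added on the right: there `d_i` and `p_ia` already stand in their normally ordered
    -- place, and only `Y_a` has to move left past the earlier rows. The sign is the same before and
    -- after `Θ`.
    induction l using List.reverseRecOn with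
    | nil =>
      simp only [List.map_nil, List.prod_nil, Algebra.TensorProduct.one_def, hΘ, h1]
    | append_singleton l i ih =>
      simp only [List.map_append, List.prod_append, List.map_singleton, List.prod_singleton]
      set P := (l.map (rowForm (capelliMatrix d y p))).prod with hP
      set P' := (l.map (rowForm (capelliMatrix d' y' p'))).prod with hP'
      rw [rowForm_capelliMatrix, rowForm_capelliMatrix, mul_sub, mul_sub, map_sub, hΘd, ih,
        Finset.mul_sum, Finset.mul_sum, map_sum]
      congr 1
      refine Finset.sum_congr rfl fun a _ => ?_
      rw [← mul_assoc, ← mul_assoc, hP', prod_mul_of_anticommute _ _ fun i => hac' i a, ← hP',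
        hP, prod_mul_of_anticommute _ _ fun i => hac i a, ← hP, mul_assoc, hsign, hΘp, ih]
      simp only [mul_assoc]
  have h := key (List.finRange n)
  rw [← List.ofFn_eq_map, ← List.ofFn_eq_map, prod_rowForm, prod_rowForm, rdet_eq_det, hΘ] at h
  have h' := congrArg (TensorProduct.rid ℤ S ∘ TensorProduct.map LinearMap.id (berezin n)) h
  simpa only [Function.comp_apply, TensorProduct.map_tmul, berezin_prod_gen, LinearMap.id_coe,
    id_eq, TensorProduct.rid_tmul, one_smul] using h'

end Grassmann

/-! ### Operators coefficientwise -/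

namespace Polynomial

/-- The coefficientwise application of an additive map to a polynomial. -/
noncomputable def mapCoeffs {R S : Type*} [Semiring R] [Semiring S] (q : R →+ S) :
    R[X] →+ S[X] where
  toFun p := p.sum fun n c => monomial n (q c)
  map_zero' := by simp
  map_add' p p' := sum_add_index p p' _ (by simp) (by simp)

lemma mapCoeffs_monomial {R S : Type*} [Semiring R] [Semiring S] (q : R →+ S) (n : ℕ) (c : R) :
    mapCoeffs q (monomial n c) = monomial n (q c) :=
  sum_monomial_index c (fun n c => monomial n (q c)) (by simp)

@[simp]
lemma coeff_mapCoeffs {R S : Type*} [Semiring R] [Semiring S] (q : R →+ S) (p : R[X]) (n : ℕ) :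
    (mapCoeffs q p).coeff n = q (p.coeff n) := by
  induction p using Polynomial.induction_on' with
  | add p p' h h' => rw [map_add, coeff_add, h, h', coeff_add, map_add]
  | monomial m a =>
    rw [mapCoeffs_monomial, coeff_monomial, coeff_monomial]
    split_ifs <;> simp

end Polynomial

/-! ### Right multiplication in the ring of differential operators -/

namespace OreRing

variable {R : Type*} [Ring R] (δ : NCDerivation R)

lemma ext_coeff {p q : OreRing δ} (h : ∀ i, coeff δ p i = coeff δ q i) : p = q :=
  Polynomial.ext (R := R) h

lemma C_add (r s : R) : C δ (r + s) = C δ r + C δ s := Polynomial.C_add (R := R)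

lemma C_zero : C δ 0 = 0 := Polynomial.C_0 (R := R)

lemma D_mul_C (r : R) : D δ * C δ r = C δ r * D δ + C δ (δ.toAddMonoidHom r) := by
  have h0 : ∀ i, coeff δ (C δ r * D δ) i = r * coeff δ (D δ) i := fun i => coeff_C_mul δ _ _ _
  have hC : ∀ (s : R) i, coeff δ (C δ s) i = if i = 0 then s else 0 := fun s i =>
    Polynomial.coeff_C (R := R)
  have hD : ∀ i, coeff δ (D δ) i = if 1 = i then 1 else 0 := fun i =>
    Polynomial.coeff_X (R := R)
  refine ext_coeff δ fun i => ?_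
  rcases i with _ | i
  · rw [coeff_D_mul_zero, coeff_add, h0, hC, hC, hD]
    simp
  · rw [coeff_D_mul_succ, coeff_add, h0, hC, hC, hC, hD]
    rcases i with _ | i <;> simp

lemma coeff_D_pow (n i : ℕ) : coeff δ (D δ ^ n) i = if i = n then 1 else 0 := by
  have h : D δ ^ n = (Polynomial.X ^ n : R[X]) := by
    induction n with
    | zero => rfl
    | succ n ih =>
      rw [pow_succ', D_mul, ih]
      refine Eq.trans ?_ (dMul_pow_one δ (n + 1))
      rw [pow_succ', Module.End.mul_apply, dMul_pow_one]
  rw [h]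
  exact Polynomial.coeff_X_pow (R := R) n i

/-- An operator is the sum of the terms `r_i ∂^i`. -/
lemma induction_on {motive : OreRing δ → Prop} (p : OreRing δ)
    (add : ∀ p q, motive p → motive q → motive (p + q))
    (term : ∀ r n, motive (C δ r * D δ ^ n)) : motive p := by
  refine Polynomial.induction_on' (R := R) (motive := motive) p (fun p q hp hq => add p q hp hq)
    fun n r => ?_
  have : C δ r * D δ ^ n = (Polynomial.monomial n r : R[X]) := by
    refine ext_coeff δ fun i => ?_
    rw [coeff_C_mul, coeff_D_pow]
    refine Eq.trans ?_ (Polynomial.coeff_monomial (R := R)).symm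
    by_cases h : n = i
    · simp [h]
    · simp [h, Ne.symm h]
  rw [← this]
  exact term r n

lemma coeff_mul_D_zero (p : OreRing δ) : coeff δ (p * D δ) 0 = 0 := by
  induction p using induction_on with
  | add p q hp hq => rw [add_mul, coeff_add, hp, hq, add_zero]
  | term r n => rw [mul_assoc, ← pow_succ, coeff_C_mul, coeff_D_pow]; simp

lemma coeff_mul_D_succ (p : OreRing δ) (i : ℕ) : coeff δ (p * D δ) (i + 1) = coeff δ p i := by
  induction p using induction_on with
  | add p q hp hq => rw [add_mul, coeff_add, hp, hq, coeff_add]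
  | term r n => rw [mul_assoc, ← pow_succ, coeff_C_mul, coeff_D_pow, coeff_C_mul, coeff_D_pow]; simp

lemma commute_D_C {r : R} (hr : δ.toAddMonoidHom r = 0) : Commute (D δ) (C δ r) := by
  rw [commute_iff_eq, D_mul_C, hr, C_zero, add_zero]

/-- An element killed by `δ` commutes with `∂`, so it passes through every `∂^n`. This serves for
factors that do not involve `u`, such as `λ_i` and `∂/∂x_{ia}`. -/
lemma coeff_mul_C {r : R} (hr : δ.toAddMonoidHom r = 0) (p : OreRing δ) (i : ℕ) :
    coeff δ (p * C δ r) i = coeff δ p i * r := by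
  induction p using induction_on with
  | add p q hp hq => rw [add_mul, coeff_add, hp, hq, coeff_add, add_mul]
  | term s n =>
    rw [mul_assoc, ((commute_D_C δ hr).pow_left n).eq, ← mul_assoc, C_mul_C, coeff_C_mul,
      coeff_C_mul, coeff_D_pow]
    split_ifs <;> simp

end OreRing

/-! ### Change of the coefficient algebra of differential operators -/

section DiffOps

variable {K : Type*} [Field K] {A B : Type*} [Ring A] [Algebra K A] [Ring B] [Algebra K B]

lemma valuedDeriv_tmul (f : RatFunc K) (a : A) :
    (valuedDeriv K A).toAddMonoidHom (f ⊗ₜ a) = ratDeriv K f ⊗ₜ a := rfl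

lemma ratDeriv_C (c : K) : ratDeriv K (RatFunc.C c) = 0 := by
  have := ratDeriv_div K (Polynomial.C c) 1 one_ne_zero
  simpa using this

lemma uSub_eq (c : K) : uSub c = algebraMap K[X] (RatFunc K) (Polynomial.X - Polynomial.C c) := by
  simp [uSub]

lemma uSub_ne_zero (c : K) : uSub c ≠ 0 := by
  rw [uSub_eq]
  exact RatFunc.algebraMap_ne_zero (Polynomial.X_sub_C_ne_zero _)

/-- The source of the relation `[d_i, y_aj] = - f_a y_aj` for Gaudin matrices, with `f_a = 1 / (u -
z_a)`. -/
lemma ratDeriv_inv_uSub (c : K) : ratDeriv K (uSub c)⁻¹ = -((uSub c)⁻¹ * (uSub c)⁻¹) := by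
  have := ratDeriv_div K 1 (Polynomial.X - Polynomial.C c) (Polynomial.X_sub_C_ne_zero _)
  rw [← uSub_eq] at this
  simp only [map_one, one_div] at this
  rw [this]
  simp [neg_div, pow_two]

namespace DiffOp

lemma coeff_map (φ : A →ₐ[K] B) (P : DiffOp K A) (i : ℕ) :
    OreRing.coeff _ (DiffOp.map φ P) i =
      Algebra.TensorProduct.map (AlgHom.id K (RatFunc K)) φ (OreRing.coeff _ P i) :=
  Polynomial.coeff_map (R := RatFunc K ⊗[K] A) (S := RatFunc K ⊗[K] B) _ _

lemma map_add (φ : A →ₐ[K] B) (P Q : DiffOp K A) :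
    DiffOp.map φ (P + Q) = DiffOp.map φ P + DiffOp.map φ Q :=
  Polynomial.map_add (R := RatFunc K ⊗[K] A) (S := RatFunc K ⊗[K] B) _

lemma map_C (φ : A →ₐ[K] B) (r : RatFunc K ⊗[K] A) :
    DiffOp.map φ (OreRing.C _ r) =
      OreRing.C _ (Algebra.TensorProduct.map (AlgHom.id K (RatFunc K)) φ r) :=
  Polynomial.map_C (R := RatFunc K ⊗[K] A) (S := RatFunc K ⊗[K] B) _

lemma map_D (φ : A →ₐ[K] B) : DiffOp.map φ (OreRing.D _) = OreRing.D _ :=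
  Polynomial.map_X (R := RatFunc K ⊗[K] A) (S := RatFunc K ⊗[K] B) _

lemma map_one (φ : A →ₐ[K] B) : DiffOp.map φ 1 = 1 :=
  Polynomial.map_one (R := RatFunc K ⊗[K] A) (S := RatFunc K ⊗[K] B) _

/-- The derivation acts on `K(u)` alone and `φ` on the other tensor factor alone. This compatibility
is what makes `DiffOp.map` multiplicative. -/
lemma map_valuedDeriv (φ : A →ₐ[K] B) (r : RatFunc K ⊗[K] A) :
    Algebra.TensorProduct.map (AlgHom.id K (RatFunc K)) φ
      ((valuedDeriv K A).toAddMonoidHom r) = (valuedDeriv K B).toAddMonoidHom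
        (Algebra.TensorProduct.map (AlgHom.id K (RatFunc K)) φ r) := by
  induction r using TensorProduct.induction_on with
  | zero => simp
  | add r s hr hs => simp only [_root_.map_add, hr, hs]
  | tmul f a => simp only [valuedDeriv_tmul, Algebra.TensorProduct.map_tmul, AlgHom.id_apply]

lemma map_C_mul (φ : A →ₐ[K] B) (r : RatFunc K ⊗[K] A) (P : DiffOp K A) :
    DiffOp.map φ (OreRing.C _ r * P) = DiffOp.map φ (OreRing.C _ r) * DiffOp.map φ P := by
  refine OreRing.ext_coeff _ fun i => ?_
  rw [map_C, OreRing.coeff_C_mul, coeff_map, coeff_map, OreRing.coeff_C_mul, map_mul]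

lemma map_D_mul (φ : A →ₐ[K] B) (P : DiffOp K A) :
    DiffOp.map φ (OreRing.D _ * P) = OreRing.D _ * DiffOp.map φ P := by
  refine OreRing.ext_coeff _ fun i => ?_
  rcases i with _ | i
  · rw [coeff_map, OreRing.coeff_D_mul_zero, OreRing.coeff_D_mul_zero, coeff_map, map_valuedDeriv]
  · rw [coeff_map, OreRing.coeff_D_mul_succ, OreRing.coeff_D_mul_succ, coeff_map, coeff_map,
      _root_.map_add, map_valuedDeriv]

lemma map_D_pow_mul (φ : A →ₐ[K] B) (n : ℕ) (P : DiffOp K A) :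
    DiffOp.map φ (OreRing.D _ ^ n * P) = OreRing.D _ ^ n * DiffOp.map φ P := by
  induction n with
  | zero => simp
  | succ n ih => rw [pow_succ', mul_assoc, map_D_mul, ih, pow_succ', mul_assoc]

/-- The coefficientwise application of an algebra homomorphism is a ring homomorphism. -/
noncomputable def mapHom (φ : A →ₐ[K] B) : DiffOp K A →+* DiffOp K B where
  toFun := DiffOp.map φ
  map_one' := map_one φ
  map_zero' := Polynomial.map_zero (R := RatFunc K ⊗[K] A) (S := RatFunc K ⊗[K] B) _
  map_add' := map_add φ
  map_mul' P Q := by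
    induction P using OreRing.induction_on with
    | add P P' h h' => rw [add_mul, map_add, h, h', map_add, add_mul]
    | term r n =>
      have h1 := map_D_pow_mul φ n 1
      rw [mul_one, map_one, mul_one] at h1
      rw [mul_assoc, map_C_mul, map_D_pow_mul, map_C_mul, h1, mul_assoc]

lemma map_rdet (φ : A →ₐ[K] B) {n : ℕ} (a : Matrix (Fin n) (Fin n) (DiffOp K A)) :
    DiffOp.map φ (rdet a) = rdet (a.map (DiffOp.map φ)) := by
  change mapHom φ (rdet a) = rdet (a.map (mapHom φ))
  simp only [rdet, map_sum, map_zsmul, map_list_prod, List.map_ofFn]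
  rfl

lemma map_scalar (φ : A →ₐ[K] B) (f : RatFunc K) :
    DiffOp.map φ (DiffOp.scalar A f) = DiffOp.scalar B f := by
  rw [DiffOp.scalar, map_C, Algebra.TensorProduct.map_tmul]
  simp [DiffOp.scalar]

lemma map_const (φ : A →ₐ[K] B) (x : A) :
    DiffOp.map φ (DiffOp.const x : DiffOp K A) = DiffOp.const (φ x) := by
  rw [DiffOp.const, map_C, Algebra.TensorProduct.map_tmul]
  simp [DiffOp.const]

lemma map_gaudinMatrix (φ : A →ₐ[K] B) {M N : ℕ} (z : Fin N → K) (lam : Fin M → K)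
    (e : Fin N → Fin M → Fin M → A) :
    (gaudinMatrix z lam e).map (DiffOp.map φ) = gaudinMatrix z lam fun a i j => φ (e a i j) := by
  ext1 i j
  simp only [Matrix.map_apply, gaudinMatrix, Matrix.of_apply]
  change mapHom φ _ = _
  rw [map_sub, map_sum]
  congr 1
  · split_ifs
    · rw [map_sub]
      exact congrArg₂ _ (map_D φ) (map_scalar φ _)
    · exact map_zero _
  · refine Finset.sum_congr rfl fun a _ => ?_
    rw [map_mul]
    exact congrArg₂ _ (map_scalar φ _) (map_const φ _)

end DiffOp

end DiffOps

/-! ### Normal ordering -/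

section NormalOrdering

variable {K : Type*} [Field K] {R A : Type*} [CommRing R] [Algebra K R] [Ring A] [Algebra K A]

/-- The differential operator with a given symbol: a linear map `q` from symbols to operators is
applied to the coefficients, which are written on the left. -/
noncomputable def DiffOp.ofSymbol (q : R →ₗ[K] A) : (RatFunc K ⊗[K] R)[X] →+ DiffOp K A :=
  Polynomial.mapCoeffs (LinearMap.lTensor (RatFunc K) q).toAddMonoidHom

lemma DiffOp.coeff_ofSymbol (q : R →ₗ[K] A) (F : (RatFunc K ⊗[K] R)[X]) (i : ℕ) :
    OreRing.coeff _ (DiffOp.ofSymbol q F) i = LinearMap.lTensor (RatFunc K) q (F.coeff i) :=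
  Polynomial.coeff_mapCoeffs _ _ _

lemma valuedDeriv_one_tmul (a : A) :
    (valuedDeriv K A).toAddMonoidHom ((1 : RatFunc K) ⊗ₜ a) = 0 := by
  rw [valuedDeriv_tmul, ← map_one (RatFunc.C (K := K)), ratDeriv_C, TensorProduct.zero_tmul]

open Grassmann in
/-- The matrix of symbols of the Gaudin matrix. -/
noncomputable def gaudinSymbol {M N : ℕ} (z : Fin N → K) (lam : Fin M → K)
    (x p : Fin M → Fin N → R) : Matrix (Fin M) (Fin M) (RatFunc K ⊗[K] R)[X] :=
  capelliMatrix (fun i => Polynomial.X - Polynomial.C (RatFunc.C (lam i) ⊗ₜ 1))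
    (fun a j => Polynomial.C ((uSub (z a))⁻¹ ⊗ₜ x j a)) (fun i a => Polynomial.C (1 ⊗ₜ p i a))

lemma gaudinMatrix_eq_capelliMatrix {M N : ℕ} (z : Fin N → K) (lam : Fin M → K)
    (x p : Fin M → Fin N → A) :
    gaudinMatrix z lam (fun a j i => x j a * p i a) = Grassmann.capelliMatrix
      (fun i => OreRing.D (valuedDeriv K A) - OreRing.C _ (RatFunc.C (lam i) ⊗ₜ 1))
      (fun a j => OreRing.C _ ((uSub (z a))⁻¹ ⊗ₜ x j a))
      (fun i a => OreRing.C _ (1 ⊗ₜ p i a)) := by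
  ext1 i j
  simp only [gaudinMatrix, Grassmann.capelliMatrix, Matrix.of_apply]
  refine congrArg₂ (fun s t : DiffOp K A => s - t) rfl (Finset.sum_congr rfl fun a _ => ?_)
  simp only [DiffOp.scalar, DiffOp.const, OreRing.C_mul_C, Algebra.TensorProduct.tmul_mul_tmul,
    one_mul, mul_one]

/-- The row determinant of the Gaudin matrix of a Weyl algebra is the normally ordered
determinant of its symbol. -/
theorem ofSymbol_det_gaudinSymbol {M N : ℕ} (z : Fin N → K) (lam : Fin M → K) (q : R →ₗ[K] A)
    (x p : Fin M → Fin N → R) (x' p' : Fin M → Fin N → A) (h1 : q 1 = 1)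
    (hq : ∀ c i a j b, q (x i a * c * p j b) = x' i a * q c * p' j b)
    (hx : ∀ i a j b, x' i a * x' j b = x' j b * x' i a)
    (hp : ∀ i b j a, p' i b * x' j a = x' j a * p' i b + if a = b ∧ i = j then 1 else 0) :
    DiffOp.ofSymbol q (gaudinSymbol z lam x p).det =
      rdet (gaudinMatrix z lam fun a j i => x' j a * p' i a) := by
  rw [gaudinMatrix_eq_capelliMatrix]
  -- Each `y_aj` is `x_{ja} / (u - z_a)`, and `f_a = 1 / (u - z_a)`.
  refine Grassmann.map_det_capelliMatrix _ _ _
    (fun a => OreRing.C _ ((uSub (z a))⁻¹ ⊗ₜ 1)) ?_ ?_ ?_ ?_ _ _ _ (DiffOp.ofSymbol q) ?_ ?_ ?_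
  · intro a j b k
    simp only [OreRing.C_mul_C, Algebra.TensorProduct.tmul_mul_tmul]
    rw [hx, mul_comm (uSub (z a))⁻¹]
  · intro i b a j
    simp only [OreRing.C_mul_C, Algebra.TensorProduct.tmul_mul_tmul]
    rw [hp, mul_one, one_mul, TensorProduct.tmul_add, OreRing.C_add]
    congr 1
    split_ifs
    · rfl
    · rw [TensorProduct.tmul_zero, OreRing.C_zero]
  · intro i a j
    rw [sub_mul, OreRing.D_mul_C, mul_sub, valuedDeriv_tmul, ratDeriv_inv_uSub,
      TensorProduct.neg_tmul]
    simp only [OreRing.C_mul_C, Algebra.TensorProduct.tmul_mul_tmul, one_mul, mul_one]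
    rw [mul_comm (RatFunc.C (lam i))]
    have : ∀ r : RatFunc K ⊗[K] A, OreRing.C (valuedDeriv K A) (-r) = - OreRing.C _ r :=
      fun r => Polynomial.C_neg (R := RatFunc K ⊗[K] A)
    rw [this]
    abel
  · intro a j
    simp only [OreRing.C_mul_C, Algebra.TensorProduct.tmul_mul_tmul, one_mul, mul_one]
  · refine OreRing.ext_coeff _ fun i => ?_
    rw [DiffOp.coeff_ofSymbol]
    refine Eq.trans ?_ (Polynomial.coeff_one (R := RatFunc K ⊗[K] A)).symm
    rw [Polynomial.coeff_one]
    split_ifs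
    · rw [Algebra.TensorProduct.one_def, LinearMap.lTensor_tmul, h1]
      rfl
    · rw [map_zero]
  · intro F i
    have hc : ∀ c : RatFunc K ⊗[K] R, LinearMap.lTensor (RatFunc K) q
        (c * (RatFunc.C (lam i) ⊗ₜ 1)) =
        LinearMap.lTensor (RatFunc K) q c * (RatFunc.C (lam i) ⊗ₜ 1) := by
      intro c
      induction c using TensorProduct.induction_on with
      | zero => simp
      | add c c' h h' => rw [add_mul, map_add, h, h', map_add, add_mul]
      | tmul f c =>
        simp only [Algebra.TensorProduct.tmul_mul_tmul, LinearMap.lTensor_tmul, mul_one]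
    have hl : (valuedDeriv K A).toAddMonoidHom (RatFunc.C (lam i) ⊗ₜ (1 : A)) = 0 := by
      rw [valuedDeriv_tmul, ratDeriv_C, TensorProduct.zero_tmul]
    rw [mul_sub, mul_sub, map_sub]
    congr 1
    -- With coefficients on the left, right multiplication by `∂` only shifts the coefficients, as
    -- multiplication by the symbol `v` does.
    · refine OreRing.ext_coeff _ fun k => ?_
      rcases k with _ | k
      · rw [OreRing.coeff_mul_D_zero, DiffOp.coeff_ofSymbol, Polynomial.coeff_mul_X_zero, map_zero]
      · rw [OreRing.coeff_mul_D_succ, DiffOp.coeff_ofSymbol, Polynomial.coeff_mul_X,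
          DiffOp.coeff_ofSymbol]
    · refine OreRing.ext_coeff _ fun k => ?_
      rw [OreRing.coeff_mul_C _ hl, DiffOp.coeff_ofSymbol, Polynomial.coeff_mul_C,
        DiffOp.coeff_ofSymbol, hc]
  · intro F a j i
    have hc : ∀ c : RatFunc K ⊗[K] R, LinearMap.lTensor (RatFunc K) q
        (((uSub (z a))⁻¹ ⊗ₜ x j a) * c * (1 ⊗ₜ p i a)) =
        ((uSub (z a))⁻¹ ⊗ₜ x' j a) * LinearMap.lTensor (RatFunc K) q c * (1 ⊗ₜ p' i a) := by
      intro c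
      induction c using TensorProduct.induction_on with
      | zero => simp
      | add c c' h h' => rw [mul_add, add_mul, map_add, h, h', map_add, mul_add, add_mul]
      | tmul f c =>
        simp only [Algebra.TensorProduct.tmul_mul_tmul, LinearMap.lTensor_tmul, mul_one, hq]
    refine OreRing.ext_coeff _ fun k => ?_
    rw [OreRing.coeff_mul_C _ (valuedDeriv_one_tmul _), OreRing.coeff_C_mul,
      DiffOp.coeff_ofSymbol, DiffOp.coeff_ofSymbol, Polynomial.coeff_mul_C,
      Polynomial.coeff_C_mul, hc]

/-! ### The symmetric form of the symbol -/

/-- The block matrix with diagonal blocks `U - z`, `V - λ` and off-diagonal blocks `xᵀ`, `p`. -/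
noncomputable def blockSymbol {ι κ : Type*} [DecidableEq ι] [DecidableEq κ] (z : ι → R)
    (lam : κ → R) (x p : κ → ι → R) : Matrix (ι ⊕ κ) (ι ⊕ κ) R[X][X] :=
  Matrix.fromBlocks (Matrix.diagonal fun a => Polynomial.C (Polynomial.X - Polynomial.C (z a)))
    (Matrix.of fun a i => Polynomial.C (Polynomial.C (x i a)))
    (Matrix.of fun i a => Polynomial.C (Polynomial.C (p i a)))
    (Matrix.diagonal fun i => Polynomial.X - Polynomial.C (Polynomial.C (lam i)))

open Polynomial in
/-- The determinant of the block matrix is symmetric in the two variables. -/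
lemma swap_det_blockSymbol {ι κ : Type*} [DecidableEq ι] [DecidableEq κ] [Fintype ι] [Fintype κ]
    (z : ι → R) (lam : κ → R) (x p : κ → ι → R) :
    Bivariate.swap (blockSymbol z lam x p).det =
      (blockSymbol lam z (fun a i => x i a) fun a i => p i a).det := by
  -- Exchanging the two blocks moves `x` to the lower left; the transpose returns it to the upper
  -- right, where `blockSymbol` expects it.
  rw [← Matrix.det_transpose (blockSymbol lam z _ _),
    ← Matrix.det_submatrix_equiv_self (Equiv.sumComm ι κ)]
  change (Bivariate.swap (R := R) : R[X][X] →+* R[X][X]) _ = _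
  rw [RingHom.map_det]
  congr 1
  ext1 i j
  have hC : ∀ r : R, Bivariate.swap (C (X - C r)) = (X - C (C r) : R[X][X]) := by
    intro r
    rw [C_sub, map_sub, Bivariate.swap_X, Bivariate.swap_C_C]
  have hX : ∀ r : R, Bivariate.swap (X - C (C r)) = (C (X - C r) : R[X][X]) := by
    intro r
    rw [C_sub, map_sub, Bivariate.swap_Y, Bivariate.swap_C_C]
  rcases i with i | i <;> rcases j with j | j <;>
    simp only [RingHom.mapMatrix_apply, Matrix.map_apply, Matrix.submatrix_apply,
      Matrix.transpose_apply, Equiv.sumComm_apply, Sum.swap_inl, Sum.swap_inr, blockSymbol,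
      Matrix.fromBlocks_apply₁₁, Matrix.fromBlocks_apply₁₂, Matrix.fromBlocks_apply₂₁,
      Matrix.fromBlocks_apply₂₂, Matrix.of_apply, RingHom.coe_coe, Bivariate.swap_C_C,
      Matrix.diagonal_apply]
  · by_cases h : i = j
    · rw [h, if_pos rfl, if_pos rfl]; exact hC _
    · rw [if_neg h, if_neg (Ne.symm h)]; exact map_zero _
  · by_cases h : i = j
    · rw [h, if_pos rfl, if_pos rfl]; exact hX _
    · rw [if_neg h, if_neg (Ne.symm h)]; exact map_zero _

open Polynomial in
lemma coeff_coeff_swap (F : R[X][X]) (a b : ℕ) :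
    ((Bivariate.swap F).coeff a).coeff b = (F.coeff b).coeff a := by
  induction F using Polynomial.induction_on' with
  | add F G h h' => simp only [map_add, coeff_add, h, h']
  | monomial n f =>
    induction f using Polynomial.induction_on' with
    | add f g h h' => simp only [map_add, coeff_add, h, h']
    | monomial m r =>
      rw [Bivariate.swap_monomial_monomial]
      simp only [coeff_monomial]
      by_cases h : m = a <;> by_cases h' : n = b <;> simp [h, h', coeff_monomial]

/-- The Schur complement of the upper left block, whose inverse is the diagonal matrix of the `g a`.
-/
lemma det_fromBlocks_diagonal {C : Type*} [CommRing C] {N M : ℕ} (u g : Fin N → C)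
    (hg : ∀ a, u a * g a = 1) (d : Fin M → C) (x p : Fin M → Fin N → C) :
    (Matrix.fromBlocks (Matrix.diagonal u) (Matrix.of fun a i => x i a) (Matrix.of p)
      (Matrix.diagonal d)).det =
      (∏ a, u a) * (Grassmann.capelliMatrix d (fun a j => g a * x j a) p).det := by
  let : Invertible (Matrix.diagonal u) :=
    ⟨Matrix.diagonal g, by rw [Matrix.diagonal_mul_diagonal]; simp [mul_comm, hg],
      by rw [Matrix.diagonal_mul_diagonal]; simp [hg]⟩
  rw [Matrix.det_fromBlocks₁₁, Matrix.det_diagonal]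
  congr 2
  change _ - Matrix.of p * Matrix.diagonal g * _ = _
  ext i j
  rw [Matrix.sub_apply, Matrix.mul_apply, Grassmann.capelliMatrix, Matrix.of_apply,
    Matrix.diagonal_apply]
  congr 1
  refine Finset.sum_congr rfl fun a _ => ?_
  rw [Matrix.mul_diagonal, Matrix.of_apply, Matrix.of_apply]
  ring

/-- The substitution of the rational function `u` for the inner variable. -/
noncomputable def evalSymbol (K : Type*) [Field K] (R : Type*) [CommRing R] [Algebra K R] :
    R[X] →+* RatFunc K ⊗[K] R :=
  Polynomial.eval₂RingHom (Algebra.TensorProduct.includeRight (R := K) (A := RatFunc K)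
    (B := R)).toRingHom (RatFunc.X ⊗ₜ 1)

lemma evalSymbol_monomial (n : ℕ) (c : R) :
    evalSymbol K R (Polynomial.monomial n c) = (RatFunc.X ^ n) ⊗ₜ c := by
  simp [evalSymbol, Polynomial.eval₂_monomial, Algebra.TensorProduct.tmul_pow]

lemma evalSymbol_C (c : R) : evalSymbol K R (Polynomial.C c) = 1 ⊗ₜ c := by
  simpa using evalSymbol_monomial (K := K) 0 c

lemma evalSymbol_X : evalSymbol K R Polynomial.X = RatFunc.X ⊗ₜ 1 := by
  rw [← Polynomial.monomial_one_one_eq_X, evalSymbol_monomial, pow_one]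

lemma lTensor_evalSymbol (q : R →ₗ[K] A) (f : R[X]) :
    LinearMap.lTensor (RatFunc K) q (evalSymbol K R f) =
      valuedPoly (Polynomial.mapCoeffs q.toAddMonoidHom f) := by
  induction f using Polynomial.induction_on' with
  | add f g h h' => rw [map_add, map_add, h, h', map_add, valuedPoly_add]
  | monomial n c =>
    rw [evalSymbol_monomial, Polynomial.mapCoeffs_monomial, valuedPoly_monomial,
      LinearMap.lTensor_tmul]
    rfl

lemma tmul_one_eq (c : K) : (1 : RatFunc K) ⊗ₜ[K] algebraMap K R c = RatFunc.C c ⊗ₜ 1 := by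
  rw [Algebra.algebraMap_eq_smul_one, ← TensorProduct.smul_tmul, Algebra.smul_def, mul_one]
  rfl

/-- Once `u` is a rational function, the elements `u - z_a` are invertible and the Schur complement
is available. The outer variable `v` remains as the polynomial variable. -/
lemma map_det_blockSymbol {M N : ℕ} (z : Fin N → K) (lam : Fin M → K)
    (x p : Fin M → Fin N → R) :
    (blockSymbol (fun a => algebraMap K R (z a)) (fun i => algebraMap K R (lam i)) x p).det.map
      (evalSymbol K R) =
      Polynomial.C ((∏ a, uSub (z a)) ⊗ₜ 1) * (gaudinSymbol z lam x p).det := by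
  have h := det_fromBlocks_diagonal (C := (RatFunc K ⊗[K] R)[X])
    (fun a => Polynomial.C (uSub (z a) ⊗ₜ 1)) (fun a => Polynomial.C ((uSub (z a))⁻¹ ⊗ₜ 1))
    (fun a => by
      rw [← Polynomial.C_mul, Algebra.TensorProduct.tmul_mul_tmul,
        mul_inv_cancel₀ (uSub_ne_zero _), mul_one, ← Algebra.TensorProduct.one_def,
        Polynomial.C_1])
    (fun i => Polynomial.X - Polynomial.C (RatFunc.C (lam i) ⊗ₜ 1))
    (fun i a => Polynomial.C (1 ⊗ₜ x i a)) (fun i a => Polynomial.C (1 ⊗ₜ p i a))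
  have hprod : ∏ a, Polynomial.C (uSub (z a) ⊗ₜ[K] (1 : R)) =
      Polynomial.C ((∏ a, uSub (z a)) ⊗ₜ[K] (1 : R)) := by
    have := map_prod (Polynomial.C.comp (Algebra.TensorProduct.includeLeft (R := K) (S := K)
      (A := RatFunc K) (B := R)).toRingHom) (fun a => uSub (z a)) Finset.univ
    exact this.symm
  have hg : gaudinSymbol z lam x p = Grassmann.capelliMatrix
      (fun i => Polynomial.X - Polynomial.C (RatFunc.C (lam i) ⊗ₜ 1))
      (fun a j => Polynomial.C ((uSub (z a))⁻¹ ⊗ₜ 1) * Polynomial.C (1 ⊗ₜ x j a))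
      (fun i a => Polynomial.C (1 ⊗ₜ p i a)) := by
    simp only [gaudinSymbol, ← Polynomial.C_mul, Algebra.TensorProduct.tmul_mul_tmul, mul_one,
      one_mul]
  rw [hprod, ← hg] at h
  rw [← h]
  change Polynomial.mapRingHom (evalSymbol K R) _ = _
  rw [RingHom.map_det]
  congr 1
  have hC : ∀ c : K, evalSymbol K R (Polynomial.X - Polynomial.C (algebraMap K R c)) =
      uSub c ⊗ₜ 1 := by
    intro c
    rw [map_sub, evalSymbol_X, evalSymbol_C, tmul_one_eq, ← TensorProduct.sub_tmul]
    rfl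
  ext1 i j
  rcases i with i | i <;> rcases j with j | j <;>
    simp only [RingHom.mapMatrix_apply, Matrix.map_apply, blockSymbol,
      Matrix.fromBlocks_apply₁₁, Matrix.fromBlocks_apply₁₂, Matrix.fromBlocks_apply₂₁,
      Matrix.fromBlocks_apply₂₂, Matrix.of_apply, Polynomial.coe_mapRingHom, Polynomial.map_C,
      evalSymbol_C, Matrix.diagonal_apply]
  · split_ifs
    · rw [Polynomial.map_C, hC]
    · exact Polynomial.map_zero _
  · split_ifs
    · rw [Polynomial.map_sub, Polynomial.map_X, Polynomial.map_C, evalSymbol_C, tmul_one_eq]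
    · exact Polynomial.map_zero _

/-- Since `v` occurs only on the diagonal, the determinant is a characteristic polynomial, hence
monic of degree `M` in `v`. -/
lemma gaudinSymbol_eq_charmatrix {M N : ℕ} (z : Fin N → K) (lam : Fin M → K)
    (x p : Fin M → Fin N → R) : ∃ B : Matrix (Fin M) (Fin M) (RatFunc K ⊗[K] R),
      gaudinSymbol z lam x p = B.charmatrix := by
  refine ⟨Matrix.of fun i j => (if i = j then RatFunc.C (lam i) ⊗ₜ 1 else 0) +
    ∑ a, ((uSub (z a))⁻¹ ⊗ₜ x j a) * (1 ⊗ₜ p i a), ?_⟩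
  ext1 i j
  rw [Matrix.charmatrix_apply, Matrix.diagonal_apply]
  simp only [gaudinSymbol, Grassmann.capelliMatrix, Matrix.of_apply, ← Polynomial.C_mul,
    ← map_sum, map_add]
  split_ifs with h
  · abel
  · simp

lemma coeff_det_gaudinSymbol {M N : ℕ} (z : Fin N → K) (lam : Fin M → K)
    (x p : Fin M → Fin N → R) :
    (gaudinSymbol z lam x p).det.coeff M = 1 ∧
      ∀ b, M < b → (gaudinSymbol z lam x p).det.coeff b = 0 := by
  obtain ⟨B, hB⟩ := gaudinSymbol_eq_charmatrix z lam x p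
  have hB' : (gaudinSymbol z lam x p).det = B.charpoly := by rw [hB, Matrix.charpoly]
  rw [hB']
  rcases subsingleton_or_nontrivial (RatFunc K ⊗[K] R) with hs | hn
  · exact ⟨Subsingleton.elim _ _, fun b _ => Subsingleton.elim _ _⟩
  · have hd := B.charpoly_natDegree_eq_dim
    rw [Fintype.card_fin] at hd
    refine ⟨?_, fun b hb => Polynomial.coeff_eq_zero_of_natDegree_lt (hd.trans_lt hb)⟩
    have := B.charpoly_monic
    rwa [Polynomial.Monic, Polynomial.leadingCoeff, hd] at this

end NormalOrdering

/-! ### Polynomials with coefficients in an algebra -/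

section ValuedPoly

variable {K : Type*} [Field K] {A B : Type*} [Ring A] [Algebra K A] [Ring B] [Algebra K B]

/-- The inclusion of `K[u]` in `K(u)` has a `K`-linear left inverse; tensored with `A`, it recovers
the coefficients. -/
lemma valuedPoly_injective : Function.Injective (valuedPoly : A[X] → RatFunc K ⊗[K] A) := by
  obtain ⟨g, hg⟩ := LinearMap.exists_leftInverse_of_injective
    ((IsScalarTower.toAlgHom K K[X] (RatFunc K)).toLinearMap)
    (LinearMap.ker_eq_bot.2 (RatFunc.algebraMap_injective K))
  have hX : ∀ n : ℕ, g (RatFunc.X ^ n) = Polynomial.X ^ n := by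
    intro n
    have := LinearMap.congr_fun hg (Polynomial.X ^ n)
    simpa [RatFunc.algebraMap_X] using this
  have key : ∀ (p : A[X]) (n : ℕ), TensorProduct.lid K A
      (LinearMap.rTensor A (Polynomial.lcoeff K n ∘ₗ g) (valuedPoly p)) = p.coeff n := by
    intro p n
    induction p using Polynomial.induction_on' with
    | add p q hp hq => rw [valuedPoly_add, map_add, map_add, hp, hq, Polynomial.coeff_add]
    | monomial m a =>
      rw [valuedPoly_monomial, LinearMap.rTensor_tmul, TensorProduct.lid_tmul,
        LinearMap.comp_apply, hX, Polynomial.lcoeff_apply, Polynomial.coeff_X_pow,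
        Polynomial.coeff_monomial]
      by_cases h : m = n
      · simp [h]
      · simp [h, Ne.symm h]
  intro p p' h
  ext n
  rw [← key, ← key, h]

lemma valuedPoly_zero : valuedPoly (K := K) (0 : A[X]) = 0 := by simp [valuedPoly]

lemma valuedPoly_one : valuedPoly (K := K) (1 : A[X]) = 1 := by
  rw [← Polynomial.monomial_zero_one, valuedPoly_monomial, pow_zero,
    Algebra.TensorProduct.one_def]

lemma valuedPoly_map_mul (Q : K[X]) (P : A[X]) :
    valuedPoly (Q.map (algebraMap K A) * P) =
      (algebraMap K[X] (RatFunc K) Q ⊗ₜ 1) * valuedPoly P := by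
  induction P using Polynomial.induction_on' with
  | add P P' h h' => rw [mul_add, valuedPoly_add, h, h', valuedPoly_add, mul_add]
  | monomial m a =>
    induction Q using Polynomial.induction_on' with
    | add Q Q' h h' =>
      rw [Polynomial.map_add, add_mul, valuedPoly_add, h, h', map_add, TensorProduct.add_tmul,
        add_mul]
    | monomial n c =>
      rw [Polynomial.map_monomial, Polynomial.monomial_mul_monomial, valuedPoly_monomial,
        valuedPoly_monomial, Algebra.TensorProduct.tmul_mul_tmul, one_mul, ← Algebra.smul_def,
        ← TensorProduct.smul_tmul, ← Polynomial.C_mul_X_pow_eq_monomial, map_mul, map_pow,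
        RatFunc.algebraMap_X, RatFunc.algebraMap_C, pow_add, mul_assoc, Algebra.smul_def]
      rfl

lemma map_valuedPoly (φ : A →ₐ[K] B) (p : A[X]) :
    Algebra.TensorProduct.map (AlgHom.id K (RatFunc K)) φ (valuedPoly p) =
      valuedPoly (p.map φ.toRingHom) := by
  induction p using Polynomial.induction_on' with
  | add p q hp hq => rw [valuedPoly_add, map_add, hp, hq, Polynomial.map_add, valuedPoly_add]
  | monomial n a =>
    rw [valuedPoly_monomial, Polynomial.map_monomial, valuedPoly_monomial,
      Algebra.TensorProduct.map_tmul]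
    rfl

lemma valuedPoly_eq_sum (p : A[X]) (n : ℕ) (h : ∀ k, n < k → p.coeff k = 0) :
    valuedPoly (K := K) p = ∑ k : Fin (n + 1), (RatFunc.X ^ (k : ℕ)) ⊗ₜ p.coeff k := by
  rw [Fin.sum_univ_eq_sum_range (fun k => (RatFunc.X ^ k : RatFunc K) ⊗ₜ[K] p.coeff k)]
  refine Polynomial.sum_over_range' p (f := fun k c => (RatFunc.X ^ k : RatFunc K) ⊗ₜ[K] c)
    (fun _ => TensorProduct.tmul_zero _ _) (n + 1) ?_
  rw [Nat.lt_succ_iff, Polynomial.natDegree_le_iff_coeff_eq_zero]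
  exact h

lemma coeff_map_mul_mem (S : Subalgebra K A) (Q : K[X]) (P : A[X]) (h : ∀ n, P.coeff n ∈ S)
    (n : ℕ) : (Q.map (algebraMap K A) * P).coeff n ∈ S := by
  rw [Polynomial.coeff_mul]
  refine sum_mem fun k _ => mul_mem ?_ (h _)
  rw [Polynomial.coeff_map]
  exact S.algebraMap_mem _

/-- The coefficient of `(u - c) P` at `n + 1` is `P_n - c P_{n+1}`, so membership descends from the
top degree of `P`. -/
lemma coeff_mem_of_X_sub_C_mul (S : Subalgebra K A) (c : K) (P : A[X])
    (h : ∀ n, ((Polynomial.X - Polynomial.C c).map (algebraMap K A) * P).coeff n ∈ S) (n : ℕ) :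
    P.coeff n ∈ S := by
  have key : ∀ m n, P.natDegree < n + m → P.coeff n ∈ S := by
    intro m
    induction m with
    | zero =>
      intro n hn
      rw [Polynomial.coeff_eq_zero_of_natDegree_lt (by simpa using hn)]
      exact S.zero_mem
    | succ m ih =>
      intro n hn
      have h1 := h (n + 1)
      rw [Polynomial.map_sub, Polynomial.map_X, Polynomial.map_C, sub_mul, Polynomial.coeff_sub,
        Polynomial.coeff_X_mul, Polynomial.coeff_C_mul] at h1
      have h2 := add_mem h1 (mul_mem (S.algebraMap_mem c) (ih (n + 1) (by omega)))
      rwa [sub_add_cancel] at h2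
  exact key (P.natDegree + 1) n (by omega)

/-- Division by a product of linear factors does not leave the subalgebra of the coefficients. -/
lemma coeff_mem_of_prod_pow_mul {ι : Type*} [Fintype ι] (z : ι → K) (k : ℕ) (S : Subalgebra K A)
    (P : A[X]) (h : ∀ n, (((∏ a, (Polynomial.X - Polynomial.C (z a))) ^ k).map
      (algebraMap K A) * P).coeff n ∈ S) (n : ℕ) : P.coeff n ∈ S := by
  -- The polynomials that can be divided out are closed under products, which reduces the claim to
  -- one linear factor.
  let T : Submonoid K[X] :=
    { carrier := {Q | ∀ P : A[X], (∀ n, (Q.map (algebraMap K A) * P).coeff n ∈ S) →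
        ∀ n, P.coeff n ∈ S}
      one_mem' := fun P hP => by simpa using hP
      mul_mem' := fun {Q Q'} hQ hQ' P hP => by
        refine hQ' P (hQ _ fun n => ?_)
        rw [← mul_assoc, ← Polynomial.map_mul]
        exact hP n }
  have hT : (∏ a, (Polynomial.X - Polynomial.C (z a))) ^ k ∈ T :=
    pow_mem (Submonoid.prod_mem T fun a _ =>
      show _ ∈ {Q | _} from coeff_mem_of_X_sub_C_mul S (z a)) k
  exact hT P h n

end ValuedPoly

/-! ### Symbols of Gaudin operators and their Bethe subalgebras -/

section Capelli

variable {K : Type*} [Field K] {R A : Type*} [CommRing R] [Algebra K R] [Ring A] [Algebra K A]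

/-- The linear map `q` from commutative symbols to operators is a normal ordering map with the
symbols of `x'_i` to the left of the symbols of `p'_i`, for canonically conjugate `x'`, `p'`. -/
structure IsNormalOrdering {σ : Type*} [DecidableEq σ] (q : R →ₗ[K] A) (x p : σ → R)
    (x' p' : σ → A) : Prop where
  map_one : q 1 = 1
  map_mul : ∀ c s t, q (x s * c * p t) = x' s * q c * p' t
  comm : ∀ s t, x' s * x' t = x' t * x' s
  ccr : ∀ s t, p' s * x' t = x' t * p' s + if s = t then 1 else 0

/-- The polynomial in `u` whose coefficients are the operators `A_ab` for a given `b`. -/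
noncomputable def capelliPoly {ι κ : Type*} [Fintype ι] [Fintype κ] [DecidableEq ι] [DecidableEq κ]
    (q : R →ₗ[K] A) (z : ι → K) (lam : κ → K) (x p : κ → ι → R) (b : ℕ) : A[X] :=
  Polynomial.mapCoeffs q.toAddMonoidHom
    ((blockSymbol (fun a => algebraMap K R (z a)) (fun i => algebraMap K R (lam i)) x p).det.coeff
      b)

/-- The duality itself. The same map `q` serves on both sides because both orderings put `x` to the
left of `p`. -/
lemma coeff_capelliPoly_swap {ι κ : Type*} [Fintype ι] [Fintype κ] [DecidableEq ι]
    [DecidableEq κ] (q : R →ₗ[K] A) (z : ι → K) (lam : κ → K) (x p : κ → ι → R) (a b : ℕ) :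
    (capelliPoly q lam z (fun a i => x i a) (fun a i => p i a) a).coeff b =
      (capelliPoly q z lam x p b).coeff a := by
  rw [capelliPoly, capelliPoly, Polynomial.coeff_mapCoeffs, Polynomial.coeff_mapCoeffs,
    ← swap_det_blockSymbol, coeff_coeff_swap]

lemma prod_uSub_eq {N : ℕ} (z : Fin N → K) : ∏ a, uSub (z a) =
    algebraMap K[X] (RatFunc K) (∏ a, (Polynomial.X - Polynomial.C (z a))) := by
  rw [map_prod]
  exact Finset.prod_congr rfl fun a _ => uSub_eq _

variable {M N : ℕ} {q : R →ₗ[K] A} {σ : Type*} [DecidableEq σ] {x p : σ → R} {x' p' : σ → A}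
  (var : Fin M → Fin N → σ)

/-- Being `K`-linear, `q` tensored with `K(u)` commutes with multiplication by the scalar function
`∏_a (u - z_a)`. -/
lemma capelliPoly_eq_ofSymbol (q : R →ₗ[K] A) (z : Fin N → K) (lam : Fin M → K)
    (x p : Fin M → Fin N → R) (b : ℕ) :
    valuedPoly (capelliPoly q z lam x p b) = ((∏ a, uSub (z a)) ⊗ₜ 1) *
      LinearMap.lTensor (RatFunc K) q ((gaudinSymbol z lam x p).det.coeff b) := by
  rw [capelliPoly, ← lTensor_evalSymbol, ← Polynomial.coeff_map, map_det_blockSymbol,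
    Polynomial.coeff_C_mul]
  generalize (gaudinSymbol z lam x p).det.coeff b = c
  induction c using TensorProduct.induction_on with
  | zero => simp
  | add c c' h h' => rw [mul_add, map_add, h, h', map_add, mul_add]
  | tmul f c =>
    rw [Algebra.TensorProduct.tmul_mul_tmul, LinearMap.lTensor_tmul, LinearMap.lTensor_tmul,
      Algebra.TensorProduct.tmul_mul_tmul, one_mul, one_mul]

lemma capelliPoly_top (h1 : q 1 = 1) (z : Fin N → K) (lam : Fin M → K)
    (x p : Fin M → Fin N → R) : capelliPoly q z lam x p M =
      (∏ a, (Polynomial.X - Polynomial.C (z a))).map (algebraMap K A) := by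
  apply valuedPoly_injective (K := K)
  have h := valuedPoly_map_mul (A := A) (∏ a, (Polynomial.X - Polynomial.C (z a))) 1
  rw [mul_one, valuedPoly_one, mul_one] at h
  rw [capelliPoly_eq_ofSymbol, (coeff_det_gaudinSymbol z lam x p).1, h, ← prod_uSub_eq,
    Algebra.TensorProduct.one_def, LinearMap.lTensor_tmul, h1, ← Algebra.TensorProduct.one_def,
    mul_one]

lemma capelliPoly_eq_zero (q : R →ₗ[K] A) (z : Fin N → K) (lam : Fin M → K)
    (x p : Fin M → Fin N → R) {b : ℕ} (hb : M < b) : capelliPoly q z lam x p b = 0 := by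
  apply valuedPoly_injective (K := K)
  rw [capelliPoly_eq_ofSymbol, (coeff_det_gaudinSymbol z lam x p).2 b hb, map_zero, mul_zero,
    valuedPoly_zero]

/-- By duality, the bound on the degree in `u` is the bound on the order for the dual system. -/
lemma coeff_capelliPoly_eq_zero (q : R →ₗ[K] A) (z : Fin N → K) (lam : Fin M → K)
    (x p : Fin M → Fin N → R) {a : ℕ} (b : ℕ) (ha : N < a) :
    (capelliPoly q z lam x p b).coeff a = 0 := by
  rw [← coeff_capelliPoly_swap, capelliPoly_eq_zero _ _ _ _ _ ha, Polynomial.coeff_zero]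

/-- The generalized Capelli identity. -/
lemma coeff_rdet_gaudinMatrix (hq : IsNormalOrdering q x p x' p')
    (hvar : ∀ i a j b, var i a = var j b → i = j ∧ a = b) (z : Fin N → K) (lam : Fin M → K)
    (b : ℕ) : ((∏ a, uSub (z a)) ⊗ₜ 1) * OreRing.coeff _ (rdet (gaudinMatrix z lam
        fun a j i => x' (var j a) * p' (var i a))) b =
      valuedPoly (capelliPoly q z lam (fun i a => x (var i a)) (fun i a => p (var i a)) b) := by
  rw [capelliPoly_eq_ofSymbol, ← DiffOp.coeff_ofSymbol, ofSymbol_det_gaudinSymbol z lam q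
    _ _ (fun i a => x' (var i a)) (fun i a => p' (var i a)) hq.map_one
    (fun c i a j b => hq.map_mul _ _ _) (fun _ _ _ _ => hq.comm _ _)]
  intro i b j a
  rw [hq.ccr]
  congr 1
  by_cases h : a = b ∧ i = j
  · rw [if_pos h, if_pos (by rw [h.1, h.2])]
  · rw [if_neg h, if_neg fun e => h ⟨(hvar _ _ _ _ e).2.symm, (hvar _ _ _ _ e).1⟩]

lemma scalar_mul_rdet_gaudinMatrix (hq : IsNormalOrdering q x p x' p')
    (hvar : ∀ i a j b, var i a = var j b → i = j ∧ a = b) (z : Fin N → K) (lam : Fin M → K) :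
    DiffOp.scalar A (∏ a, uSub (z a)) *
        rdet (gaudinMatrix z lam fun a j i => x' (var j a) * p' (var i a)) =
      ∑ a : Fin (N + 1), ∑ b : Fin (M + 1),
        DiffOp.const ((capelliPoly q z lam (fun i a => x (var i a)) (fun i a => p (var i a))
          b).coeff a) * DiffOp.scalar A (RatFunc.X ^ (a : ℕ)) * DiffOp.partial A ^ (b : ℕ) := by
  refine OreRing.ext_coeff _ fun k => ?_
  have hsum : ∀ {n : ℕ} (F : Fin n → DiffOp K A), OreRing.coeff _ (∑ a, F a) k =
      ∑ a, OreRing.coeff _ (F a) k := fun F =>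
    Polynomial.finsetSum_coeff (R := RatFunc K ⊗[K] A) _ _ _
  rw [DiffOp.scalar, OreRing.coeff_C_mul, coeff_rdet_gaudinMatrix var hq hvar,
    valuedPoly_eq_sum _ N fun a ha => coeff_capelliPoly_eq_zero _ _ _ _ _ _ ha, hsum]
  refine Finset.sum_congr rfl fun a _ => ?_
  rw [hsum]
  have hterm : ∀ b : Fin (M + 1), OreRing.coeff _ (DiffOp.const ((capelliPoly q z lam
      (fun i a => x (var i a)) (fun i a => p (var i a)) b).coeff a) *
      DiffOp.scalar A (RatFunc.X ^ (a : ℕ)) * DiffOp.partial A ^ (b : ℕ)) k =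
      if k = b then (RatFunc.X ^ (a : ℕ)) ⊗ₜ[K] ((capelliPoly q z lam
      (fun i a => x (var i a)) (fun i a => p (var i a)) b).coeff a) else 0 := by
    intro b
    rw [DiffOp.const, DiffOp.scalar, DiffOp.partial, OreRing.C_mul_C, OreRing.coeff_C_mul,
      OreRing.coeff_D_pow, Algebra.TensorProduct.tmul_mul_tmul, one_mul, mul_one]
    split_ifs
    · rw [mul_one]
    · rw [mul_zero]
  rw [Finset.sum_congr rfl fun b _ => hterm b]
  by_cases hk : k < M + 1
  · rw [Finset.sum_eq_single ⟨k, hk⟩]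
    · rw [if_pos rfl]
    · intro b _ hb
      rw [if_neg fun e => hb (Fin.ext e.symm)]
    · simp
  · rw [capelliPoly_eq_zero _ _ _ _ _ (by omega), Polynomial.coeff_zero, TensorProduct.tmul_zero]
    symm
    refine Finset.sum_eq_zero fun b _ => if_neg ?_
    have := b.2
    omega

/-- The image of the Bethe subalgebra is generated by the operators `A_ab`. -/
lemma map_betheSubalgebra (hq : IsNormalOrdering q x p x' p')
    (hvar : ∀ i a j b, var i a = var j b → i = j ∧ a = b) (z : Fin N → K) (lam : Fin M → K)
    (φ : UglTensor K M N →ₐ[K] A)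
    (hφ : ∀ a j i, φ (glE K M N a j i) = x' (var j a) * p' (var i a)) :
    (betheSubalgebra M N z lam).map φ = Algebra.adjoin K {y | ∃ a b : ℕ,
      y = (capelliPoly q z lam (fun i a => x (var i a)) (fun i a => p (var i a)) b).coeff a} := by
  set P := capelliPoly q z lam (fun i a => x (var i a)) (fun i a => p (var i a)) with hP
  set W : K[X] := ∏ a, (Polynomial.X - Polynomial.C (z a)) with hW
  have hG : DiffOp.map φ (rdet (Gtilde M N z lam)) =
      rdet (gaudinMatrix z lam fun a j i => x' (var j a) * p' (var i a)) := by
    rw [DiffOp.map_rdet, Gtilde, DiffOp.map_gaudinMatrix]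
    simp only [hφ]
  -- Of the `k + 1` factors `W` that clear the poles of the transfer matrix, one is absorbed in `P`
  -- and `k` remain.
  have key : ∀ (k : ℕ) (f : (UglTensor K M N)[X]), valuedPoly f =
      ((∏ a, uSub (z a) ^ (k + 1)) ⊗ₜ[K] (1 : UglTensor K M N)) *
        transferMatrix M N z lam (k + 1) →
      f.map φ.toRingHom = (W ^ k).map (algebraMap K A) * P (M - (k + 1)) := by
    intro k f hf
    apply valuedPoly_injective (K := K)
    rw [valuedPoly_map_mul, hP, ← coeff_rdet_gaudinMatrix var hq hvar, ← map_valuedPoly, hf,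
      map_mul, transferMatrix, ← DiffOp.coeff_map, hG, Algebra.TensorProduct.map_tmul, map_one,
      ← mul_assoc, Algebra.TensorProduct.tmul_mul_tmul, one_mul, AlgHom.id_apply, map_pow,
      ← prod_uSub_eq, ← pow_succ, Finset.prod_pow]
  rw [betheSubalgebra, AlgHom.map_adjoin]
  refine le_antisymm (Algebra.adjoin_le ?_) (Algebra.adjoin_le ?_)
  · rintro _ ⟨_, ⟨i, hi1, hiM, f, hf, n, rfl⟩, rfl⟩
    obtain ⟨k, rfl⟩ : ∃ k, i = k + 1 := ⟨i - 1, by omega⟩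
    have h := congrArg (fun g => g.coeff n) (key k f hf)
    simp only [Polynomial.coeff_map] at h
    change φ.toRingHom (f.coeff n) ∈ _
    rw [h]
    exact coeff_map_mul_mem _ _ _ (fun m => Algebra.subset_adjoin (Set.mem_ofPred.2
      ⟨m, M - (k + 1), rfl⟩)) n
  · rintro _ ⟨a, b, rfl⟩
    -- For `b < M` the transfer matrix with index `M - b` gives `P b` up to a power of `W`. For `b =
    -- M` the coefficients are scalars, as `P M` is the image of `W`; beyond that they vanish.
    rcases lt_trichotomy b M with hb | rfl | hb
    · obtain ⟨f, hf⟩ := exists_transferMatrix_polynomial M N z lam (M - b - 1 + 1) (by omega)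
      have h := key _ f hf
      rw [show M - (M - b - 1 + 1) = b by omega] at h
      refine coeff_mem_of_prod_pow_mul z (M - b - 1) _ (P b) (fun n => ?_) a
      rw [← h, Polynomial.coeff_map]
      exact Algebra.subset_adjoin ⟨f.coeff n,
        ⟨M - b - 1 + 1, by omega, by omega, f, hf, n, rfl⟩, rfl⟩
    · rw [hP, capelliPoly_top hq.map_one, Polynomial.coeff_map]
      exact Subalgebra.algebraMap_mem _ _
    · rw [hP, capelliPoly_eq_zero _ _ _ _ _ hb, Polynomial.coeff_zero]
      exact Subalgebra.zero_mem _

end Capelli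

/-! ### The Weyl algebra -/

section Weyl

variable (K : Type*) [Field K] (σ : Type*)

/-- The commutator is a derivation that vanishes on all variables. -/
lemma pderiv_mul_comm (s t : σ) :
    (MvPolynomial.pderiv s : Derivation K (MvPolynomial σ K) (MvPolynomial σ K)).toLinearMap *
        (MvPolynomial.pderiv t).toLinearMap =
      (MvPolynomial.pderiv t).toLinearMap * (MvPolynomial.pderiv s).toLinearMap := by
  classical
  have key : ⁅(MvPolynomial.pderiv s : Derivation K (MvPolynomial σ K) (MvPolynomial σ K)),
      (MvPolynomial.pderiv t : Derivation K (MvPolynomial σ K) (MvPolynomial σ K))⁆ = 0 := by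
    refine MvPolynomial.derivation_ext fun r => ?_
    rw [Derivation.commutator_apply]
    simp [MvPolynomial.pderiv_X, Pi.single_apply, apply_ite]
  refine LinearMap.ext fun f => ?_
  have := DFunLike.congr_fun key f
  rw [Derivation.commutator_apply] at this
  exact sub_eq_zero.1 this

/-- Polynomials in the `∂/∂x_s` as operators on polynomials. -/
noncomputable def partialHom : MvPolynomial σ K →ₐ[K] Module.End K (MvPolynomial σ K) :=
  let D : Set (Module.End K (MvPolynomial σ K)) :=
    Set.range fun s => (MvPolynomial.pderiv s).toLinearMap
  -- `MvPolynomial.aeval` needs a commutative target, so the substitution is made in the subalgebra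
  -- generated by the partial derivatives.
  haveI : IsMulCommutative (Algebra.adjoin K D) := Algebra.isMulCommutative_adjoin K (by
    rintro _ ⟨s, rfl⟩ _ ⟨t, rfl⟩
    exact pderiv_mul_comm K σ s t)
  letI : CommRing (Algebra.adjoin K D) :=
    { (Algebra.adjoin K D).toRing with mul_comm := IsMulCommutative.is_comm.comm }
  (Algebra.adjoin K D).val.comp
    (MvPolynomial.aeval fun s => (⟨(MvPolynomial.pderiv s).toLinearMap,
      Algebra.subset_adjoin (Set.mem_range_self s)⟩ : Algebra.adjoin K D))

lemma partialHom_X (s : σ) :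
    partialHom K σ (MvPolynomial.X s) = (MvPolynomial.pderiv s).toLinearMap := by
  rw [partialHom]
  simp

/-- The normally ordered operator with a given symbol. -/
noncomputable def normalOrder :
    MvPolynomial σ K ⊗[K] MvPolynomial σ K →ₗ[K] Module.End K (MvPolynomial σ K) :=
  LinearMap.mul' K _ ∘ₗ TensorProduct.map (Algebra.lmul K (MvPolynomial σ K)).toLinearMap
    (partialHom K σ).toLinearMap

lemma normalOrder_tmul (f g : MvPolynomial σ K) :
    normalOrder K σ (f ⊗ₜ g) = Algebra.lmul K (MvPolynomial σ K) f * partialHom K σ g := rfl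

/-- The operator of `f ⊗ g` is `f · g(∂)`, so a further `x_s` joins it on the left and a further
`∂/∂x_t` on the right. The canonical commutation relation is the Leibniz rule. -/
lemma isNormalOrdering_normalOrder [DecidableEq σ] :
    IsNormalOrdering (normalOrder K σ) (fun s => MvPolynomial.X s ⊗ₜ 1)
      (fun s => 1 ⊗ₜ MvPolynomial.X s) (fun s => LinearMap.mulLeft K (MvPolynomial.X s))
      (fun s => (MvPolynomial.pderiv s).toLinearMap) where
  map_one := by
    rw [Algebra.TensorProduct.one_def, normalOrder_tmul, map_one, map_one, one_mul]
  map_mul c s t := by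
    induction c using TensorProduct.induction_on with
    | zero => simp
    | add c c' h h' => rw [mul_add, add_mul, map_add, h, h', map_add, mul_add, add_mul]
    | tmul f g =>
      simp only [Algebra.TensorProduct.tmul_mul_tmul, one_mul, mul_one, normalOrder_tmul, map_mul,
        partialHom_X, mul_assoc]
      rfl
  comm s t := by
    refine LinearMap.ext fun f => ?_
    simp only [Module.End.mul_apply, LinearMap.mulLeft_apply]
    ring
  ccr s t := by
    refine LinearMap.ext fun f => ?_
    have h : MvPolynomial.pderiv s (MvPolynomial.X t : MvPolynomial σ K) =
        if s = t then 1 else 0 := by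
      rw [MvPolynomial.pderiv_X, Pi.single_apply]
      simp only [eq_comm]
    simp only [Module.End.mul_apply, LinearMap.mulLeft_apply, LinearMap.add_apply,
      Derivation.coeFn_coe, Derivation.leibniz, smul_eq_mul, h]
    split_ifs <;> simp

end Weyl

/-! ### The duality theorem -/

theorem theorem3p1 {K : Type*} [Field K] [CharZero K] (M N : ℕ)
    (z : Fin N → K) (lam : Fin M → K)
    (hz : Function.Injective z) (hlam : Function.Injective lam) :
    (betheSubalgebra M N z lam).map (piM K M N) =
        (betheSubalgebra N M lam z).map (piN K M N) ∧
      ∃ AM AN : Fin (N + 1) → Fin (M + 1) → Module.End K (MvPolynomial (Fin M × Fin N) K),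
        DiffOp.scalar _ (∏ a, uSub (z a)) *
            DiffOp.map (piM K M N) (rdet (Gtilde M N z lam)) =
          ∑ a, ∑ b, DiffOp.const (AM a b) * DiffOp.scalar _ (RatFunc.X ^ (a : ℕ)) *
            DiffOp.partial _ ^ (b : ℕ) ∧
        DiffOp.scalar _ (∏ b, uSub (lam b)) *
            DiffOp.map (piN K M N) (rdet (Gtilde N M lam z)) =
          ∑ a, ∑ b, DiffOp.const (AN a b) * DiffOp.scalar _ (RatFunc.X ^ (b : ℕ)) *
            DiffOp.partial _ ^ (a : ℕ) ∧
        AM = AN := by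
  have hq := isNormalOrdering_normalOrder K (Fin M × Fin N)
  have hvar : ∀ (i : Fin M) (a : Fin N) j b, (i, a) = (j, b) → i = j ∧ a = b :=
    fun i a j b h => Prod.mk.inj h
  have hvar' : ∀ (a : Fin N) (i : Fin M) b j, (i, a) = (j, b) → a = b ∧ i = j :=
    fun a i b j h => (Prod.mk.inj h).symm
  have hswap := coeff_capelliPoly_swap (normalOrder K (Fin M × Fin N)) z lam
    (fun i a => MvPolynomial.X (i, a) ⊗ₜ 1) (fun i a => 1 ⊗ₜ MvPolynomial.X (i, a))
  -- One family of operators serves for both sides: the normally ordered coefficients of the block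
  -- determinant. The final `rfl` identifies the second family with it.
  refine ⟨?_, fun a b => (capelliPoly (normalOrder K (Fin M × Fin N)) z lam
    (fun i a => MvPolynomial.X (i, a) ⊗ₜ 1) (fun i a => 1 ⊗ₜ MvPolynomial.X (i, a)) b).coeff a,
    _, ?_, ?_, rfl⟩
  · rw [map_betheSubalgebra (fun i a => (i, a)) hq hvar z lam (piM K M N) (piM_glE K M N),
      map_betheSubalgebra (fun a i => (i, a)) hq hvar' lam z (piN K M N)
        fun a j i => piN_glE K M N a j i]
    -- Both generating sets now consist of the same `A_ab`, up to the order in which `a` and `b` are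
    -- quantified.
    simp only [hswap]
    congr 1
    ext y
    exact exists_comm
  · rw [DiffOp.map_rdet, Gtilde, DiffOp.map_gaudinMatrix]
    simp only [piM_glE]
    exact scalar_mul_rdet_gaudinMatrix (fun i a => (i, a)) hq hvar z lam
  · rw [DiffOp.map_rdet, Gtilde, DiffOp.map_gaudinMatrix]
    simp only [piN_glE]
    refine (scalar_mul_rdet_gaudinMatrix (fun a i => (i, a)) hq hvar' lam z).trans ?_
    simp only [hswap]
    exact Finset.sum_comm
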